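/- Let $b\ge 2$ and let $T$ be the $b$-ary rooted tree with root $v_0$, vertex set $\mathbb V$, in which every vertex $u$ has children $u^1,\dots,u^b$; for $u\ne v_0$ let $u^*$ be the parent of $u$, and set $v_0^*=v_0$. The root has an arbitrary colour $c(v_0)\in\{1,\dots,b\}$, and the child $u^j$ of any vertex $u$ has colour $c(u^j)=j$. Let $\mathbf p(u)=(p_{uu^*},p_{uu^1},\dots,p_{uu^b})$, $u\in\mathbb V$, be independent random vectors with values in $(0,1)^{b+1}$ whose components sum to $1$, such that the distribution of $\mathbf p(u)$ depends only on the colour $c(u)$. Given this environment, let $X$ be the Markov chain on $\mathbb V$ with $X(0)=v_0$ which jumps from $u$ to $u^*$ with probability $p_{uu^*}$ and from $u$ to $u^j$ with probability $p_{uu^j}$, $j=1,\dots,b$ (so that at the root it stays put with probability $p_{v_0v_0}=p_{v_0v_0^*}$). For $i=1,\dots,b$ let $(\bar\xi_{i1},\dots,\bar\xi_{ib})$ have the distribution of $\left(\frac{p_{uu^1}}{p_{uu^*}},\dots,\frac{p_{uu^b}}{p_{uu^*}}\right)$ for a vertex $u$ of colour $i$. Let $\mathbb D=\{s\in\mathbb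 R:\mathbb E\,\bar\xi_{ij}^{\,s}<\infty\ \text{for all } i,j\}$ and assume that $[0,1]\subseteq\mathbb D$, that $0$ is an interior point of $\mathbb D$, and that $\mathbb E|\log\bar\xi_{ij}|<\infty$ and $\mathbb E|\bar\xi_{ij}\log\bar\xi_{ij}|<\infty$ for all $i,j$. For $s\in[0,1]$ let $\rho(s)$ be the largest eigenvalue of the $b\times b$ matrix $m(s)=\left(\mathbb E\,\bar\xi_{ij}^{\,s}\right)_{i,j=1}^b$, and let $\lambda_1=\inf_{s\in[0,1]}\rho(s)$. If $\lambda_1<1$, then for almost every environment the walk is positive recurrent (the expected return time to every vertex is finite). If $\lambda_1>1$, then for almost every environment the walk is transient (from every vertex, the probability of ever returning to it is less than $1$). -/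

import Mathlib

open MeasureTheory ProbabilityTheory
open scoped ENNReal

/-! ### Markov chains with a given transition kernel -/

namespace MarkovChain

variable {S : Type*} [MeasurableSpace S]

/-- The law, on the space of trajectories `ℕ → S`, of the time-homogeneous Markov chain started at
`x` with one-step transition kernel `κ`: the conditional law of `X (n + 1)` given
`X 0, …, X n` is `κ (X n)`. -/
noncomputable def law (κ : Kernel S S) [IsMarkovKernel κ] (x : S) : Measure (ℕ → S) :=
  Kernel.traj (X := fun _ => S)
    (fun n => κ.comap (fun h : (i : Finset.Iic n) → S => h ⟨n, Finset.mem_Iic.2 le_rfl⟩)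
      (measurable_pi_apply _)) 0 (fun _ => x)

/-- The first time `n ≥ 1` at which the trajectory `X` is at `x` (`∞` if there is none). -/
noncomputable def returnTime (x : S) (X : ℕ → S) : ℝ≥0∞ :=
  ⨅ (n : ℕ) (_ : 1 ≤ n ∧ X n = x), (n : ℝ≥0∞)

/-- Every state has a finite expected return time. -/
def IsPositiveRecurrent (κ : Kernel S S) [IsMarkovKernel κ] : Prop :=
  ∀ x : S, ∫⁻ X, returnTime x X ∂(law κ x) < ∞

/-- From every state, the probability of ever returning to it is strictly less than one. -/
def IsTransient (κ : Kernel S S) [IsMarkovKernel κ] : Prop :=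
  ∀ x : S, law κ x {X | ∃ n : ℕ, 1 ≤ n ∧ X n = x} < 1

end MarkovChain

/-! ### The coloured tree and the random environment -/

namespace ColouredTree

/-- The vertices of the `b`-ary rooted tree. The root is `[]`, the children of `u` are
`j :: u` for `j : Fin b`, and the parent of `u` is `u.tail` (so the root is its own parent). -/
abbrev Vertex (b : ℕ) : Type := List (Fin b)

instance (b : ℕ) : MeasurableSpace (Vertex b) := ⊤

instance (b : ℕ) : DiscreteMeasurableSpace (Vertex b) := ⟨fun _ => trivial⟩

/-- The colour of a vertex: the `j`-th child of any vertex has colour `j`; the root has the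
prescribed colour `c₀`. -/
def colour {b : ℕ} (c₀ : Fin b) : Vertex b → Fin b
  | [] => c₀
  | j :: _ => j

/-- The possible values of `𝐩(u) = (p_{uu*}, p_{uu¹}, …, p_{uuᵇ})`: strictly positive vectors with
sum `1`. The coordinate `none` is the jump to the parent, `some j` the jump to the `j`-th child. -/
def JumpVector (b : ℕ) : Type :=
  {q : Option (Fin b) → ℝ // (∀ a, 0 < q a) ∧ ∑ a, q a = 1}

instance (b : ℕ) : MeasurableSpace (JumpVector b) :=
  inferInstanceAs (MeasurableSpace {q : Option (Fin b) → ℝ // (∀ a, 0 < q a) ∧ ∑ a, q a = 1})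

/-- The endpoint of the jump with label `a` from the vertex `u`. -/
def target {b : ℕ} (u : Vertex b) : Option (Fin b) → Vertex b
  | none => u.tail
  | some j => j :: u

/-- The transition kernel of the random walk in the (frozen) environment `e`:
from `u` the walk jumps to `target u a` with probability `e u a`. -/
noncomputable def walk {b : ℕ} (e : Vertex b → JumpVector b) : Kernel (Vertex b) (Vertex b) where
  toFun u := ∑ a : Option (Fin b), ENNReal.ofReal ((e u).1 a) • Measure.dirac (target u a)
  measurable' := measurable_from_top

instance {b : ℕ} (e : Vertex b → JumpVector b) : IsMarkovKernel (walk e) := by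
  refine ⟨fun u => ⟨?_⟩⟩
  have h : walk e u =
      ∑ a : Option (Fin b), ENNReal.ofReal ((e u).1 a) • Measure.dirac (target u a) := rfl
  rw [h, Measure.finsetSum_apply]
  simp only [Measure.smul_apply, measure_univ, smul_eq_mul, mul_one]
  rw [← ENNReal.ofReal_sum_of_nonneg fun a _ => ((e u).2.1 a).le, (e u).2.2, ENNReal.ofReal_one]

/-- The ratio of the probability of the jump to the `j`-th child to that of the jump to the
parent. Under the law `ν i` of the jump vector at a vertex of colour `i`, this is `ξ̄_{ij}`. -/
noncomputable def ratio {b : ℕ} (j : Fin b) (q : JumpVector b) : ℝ :=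
  q.1 (some j) / q.1 none

/-- The matrix `m(s)` with entries `𝔼 (ξ̄_{ij})^s`. -/
noncomputable def momentMatrix {b : ℕ} (ν : Fin b → Measure (JumpVector b)) (s : ℝ) :
    Matrix (Fin b) (Fin b) ℝ :=
  Matrix.of fun i j => ∫ q, ratio j q ^ s ∂(ν i)

/-- The largest (real) eigenvalue `ρ(s)` of `m(s)`. -/
noncomputable def rho {b : ℕ} (ν : Fin b → Measure (JumpVector b)) (s : ℝ) : ℝ :=
  sSup {t : ℝ | Module.End.HasEigenvalue (Matrix.toLin' (momentMatrix ν s)) t}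

/-- `λ₁ = inf_{s ∈ [0,1]} ρ(s)`. -/
noncomputable def lambdaOne {b : ℕ} (ν : Fin b → Measure (JumpVector b)) : ℝ :=
  sInf (rho ν '' Set.Icc 0 1)

/-- The set `𝔻` of the real `s` for which all the moments `𝔼 (ξ̄_{ij})^s` are finite. -/
def momentDomain {b : ℕ} (ν : Fin b → Measure (JumpVector b)) : Set ℝ :=
  {s : ℝ | ∀ i j, Integrable (fun q => ratio j q ^ s) (ν i)}

/-- The regularity conditions on the variables `ξ̄_{ij}`. -/
structure RegularityConditions {b : ℕ} (ν : Fin b → Measure (JumpVector b)) : Prop where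
  unit_interval_subset : Set.Icc 0 1 ⊆ momentDomain ν
  zero_mem_interior : (0 : ℝ) ∈ interior (momentDomain ν)
  integrable_log : ∀ i j, Integrable (fun q => Real.log (ratio j q)) (ν i)
  integrable_mul_log : ∀ i j, Integrable (fun q => ratio j q * Real.log (ratio j q)) (ν i)

end ColouredTree

/-! The walk is an electrical network: give the edge above `u` the conductance `cond e u`, the
product of the ratios `ξ̄` along the path from the root to `u`, and the root loop conductance `1`.
Then `cond e u / p_{uu*}` is the total conductance at `u` and defines an invariant measure, which is
finite as soon as the conductances are summable. Independence and colours turn the mean of `∑ cond ^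
s` over generation `n` into a row sum of `m(s) ^ n` (`sum_lintegral_cond_eq_pow`).

If `λ₁ < 1`, some `ρ(s) < 1`, so `∑ cond ^ s` has finite mean. All but finitely many conductances
are then below `1`, where `cond ≤ cond ^ s` because `s ≤ 1`. Hence the invariant measure is finite
and the walk is positive recurrent.

If `λ₁ > 1`, a diagonal entry of one fixed power `m(s) ^ N` is at least `2` for all `s ∈ [0, 1]` at
once. Chernoff bounds, with a suitable tilting parameter `s`, then give a generation `L` and a level
`Y ≤ 1` such that the mean number of vertices of the root's colour with conductance at least `Y`
exceeds `1 / Y` (`exists_inv_lt_sum_measure_le_cond`). Repeating such blocks embeds a supercritical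
branching process. The flow that splits evenly along it has mean `1`, and its energy has bounded
mean precisely because the number of good vertices beats the loss `1 / Y` per block.

Thomson's principle, used in the form `2 c θ - c ^ 2 Q ≤ escape` that can be integrated term by
term, bounds the mean escape probability below (`quadratic_le_escape`,
`measure_escapeInf_eq_zero_lt_one`). Independence of two subtrees upgrades escape with positive
probability to escape in almost every environment. The resulting hitting probabilities form a
superharmonic function which proves transience (`isTransient_of_escapeInf_pos`). -/

open scoped NNReal

/-! ### Criteria for positive recurrence and transience of a Markov chain -/

namespace MarkovChain

section Trajectories

variable {S : Type*}

/-- The trajectories that do not visit `x` at the times `1, …, n`. -/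
def avoid (x : S) (n : ℕ) : Set (ℕ → S) := {X | ∀ m, 1 ≤ m → m ≤ n → X m ≠ x}

theorem avoid_zero (x : S) : avoid x 0 = Set.univ := by
  ext X; simp only [avoid, Set.mem_ofPred_eq, Set.mem_univ, iff_true]; intro m h1 h2; omega

theorem avoid_succ (x : S) (n : ℕ) : avoid x (n + 1) = avoid x n \ {X | X (n + 1) = x} := by
  ext X
  simp only [avoid, Set.mem_sdiff, Set.mem_ofPred_eq]
  constructor
  · intro h; exact ⟨fun m h1 h2 => h m h1 (by omega), h (n + 1) (by omega) le_rfl⟩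
  · rintro ⟨h, h'⟩ m h1 h2
    rcases Nat.lt_or_ge n m with h3 | h3
    · obtain rfl : m = n + 1 := by omega
      exact h'
    · exact h m h1 h3

/-- The event `avoid x n` says that the return time exceeds `n`, so the sum counts the times before
the return. -/
theorem returnTime_le_tsum (x : S) (X : ℕ → S) :
    returnTime x X ≤ ∑' n, (avoid x n).indicator 1 X := by
  classical
  by_cases h : ∃ n, 1 ≤ n ∧ X n = x
  · have hN := Nat.find_spec h
    set N := Nat.find h with hNdef
    calc returnTime x X ≤ N := iInf₂_le N hN
      _ = ∑ n ∈ Finset.range N, (avoid x n).indicator (1 : (ℕ → S) → ℝ≥0∞) X := by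
          rw [Finset.sum_congr rfl (g := fun _ => 1)]
          · simp
          · intro n hn
            rw [Set.indicator_of_mem, Pi.one_apply]
            intro m h1 h2 h3
            exact Nat.find_min h (lt_of_le_of_lt h2 (Finset.mem_range.1 hn)) ⟨h1, h3⟩
      _ ≤ _ := ENNReal.sum_le_tsum _
  · push Not at h
    have : ∀ n, (avoid x n).indicator (1 : (ℕ → S) → ℝ≥0∞) X = 1 := fun n => by
      rw [Set.indicator_of_mem, Pi.one_apply]
      exact fun m h1 _ => h m h1
    simp [this]

end Trajectories

section Chain

variable {S : Type*} [MeasurableSpace S] (κ : Kernel S S) [IsMarkovKernel κ]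

instance (x : S) : IsProbabilityMeasure (law κ x) := by
  unfold law; infer_instance

/-- The one-step Markov property, tested against an event of the first `n` steps. -/
theorem setLIntegral_law_succ (x : S) (n : ℕ) {A : Set ((i : Finset.Iic n) → S)}
    (hA : MeasurableSet A) {g : S → ℝ≥0∞} (hg : Measurable g) :
    ∫⁻ X in Preorder.frestrictLe n ⁻¹' A, g (X (n + 1)) ∂(law κ x) =
      ∫⁻ X in Preorder.frestrictLe n ⁻¹' A, ∫⁻ y, g y ∂(κ (X n)) ∂(law κ x) := by
  set η : (n : ℕ) → Kernel ((i : Finset.Iic n) → S) S := fun n =>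
    κ.comap (fun h : (i : Finset.Iic n) → S => h ⟨n, Finset.mem_Iic.2 le_rfl⟩)
      (measurable_pi_apply _) with hη
  have hlaw : law κ x = Kernel.traj (X := fun _ => S) η 0 (fun _ => x) := rfl
  have hmr : Measurable (Preorder.frestrictLe (π := fun _ : ℕ => S) n) :=
    Preorder.measurable_frestrictLe n
  have h1 := Kernel.partialTraj_compProd_eq_map_traj (X := fun _ => S) (κ := η) (Nat.zero_le n)
    (x₀ := fun _ => x)
  have h2 := Kernel.traj_map_frestrictLe_apply (X := fun _ => S) (κ := η) 0 n (fun _ => x)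
  rw [← hlaw] at h1 h2
  have hF : Measurable (fun z : ((i : Finset.Iic n) → S) × S => A.indicator 1 z.1 * g z.2) :=
    ((measurable_one.indicator hA).comp measurable_fst).mul (hg.comp measurable_snd)
  have h3 : ∫⁻ z, A.indicator 1 z.1 * g z.2
        ∂((law κ x).map fun X => (Preorder.frestrictLe n X, X (n + 1))) =
      ∫⁻ h, A.indicator 1 h * ∫⁻ y, g y ∂(η n h)
        ∂((law κ x).map (Preorder.frestrictLe n)) := by
    rw [← h1, Measure.lintegral_compProd hF, h2]
    refine lintegral_congr fun h => ?_
    exact lintegral_const_mul (μ := η n h) (A.indicator 1 h) hg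
  rw [lintegral_map hF (by fun_prop), lintegral_map _ hmr] at h3
  · rw [← lintegral_indicator (hmr hA), ← lintegral_indicator (hmr hA)]
    convert h3 using 3 with X X
    · by_cases h : Preorder.frestrictLe n X ∈ A
      · rw [Set.indicator_of_mem (by exact h), Set.indicator_of_mem h]; simp
      · rw [Set.indicator_of_notMem (by exact h), Set.indicator_of_notMem h]; simp
    · by_cases h : Preorder.frestrictLe n X ∈ A
      · rw [Set.indicator_of_mem (by exact h), Set.indicator_of_mem h]
        simp [hη]
      · rw [Set.indicator_of_notMem (by exact h), Set.indicator_of_notMem h]; simp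
  · exact (measurable_one.indicator hA).mul (hg.lintegral_kernel)

theorem lintegral_law_zero (x : S) {g : S → ℝ≥0∞} (hg : Measurable g) :
    ∫⁻ X, g (X 0) ∂(law κ x) = g x := by
  unfold law
  rw [Kernel.lintegral_traj _ (by fun_prop)]
  simp [Function.updateFinset]

variable [MeasurableSingletonClass S]

theorem exists_avoid_eq_preimage (x : S) (n : ℕ) :
    ∃ A : Set ((i : Finset.Iic n) → S), MeasurableSet A ∧
      avoid x n = Preorder.frestrictLe (π := fun _ : ℕ => S) n ⁻¹' A := by
  refine ⟨⋂ i : Finset.Iic n, {h | 1 ≤ i.1 → h i ≠ x}, ?_, ?_⟩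
  · refine MeasurableSet.iInter fun i => ?_
    by_cases hi : 1 ≤ i.1
    · simp only [hi, true_implies]
      exact ((measurable_pi_apply (X := fun _ : Finset.Iic n => S) i)
        (measurableSet_singleton x)).compl
    · simp [hi]
  · ext X
    simp only [avoid, Set.mem_ofPred_eq, Set.mem_preimage, Set.mem_iInter, Subtype.forall,
      Finset.mem_Iic, Preorder.frestrictLe_apply]
    exact forall_congr' fun m => ⟨fun h a b => h b a, fun h a b => h b a⟩

theorem measurableSet_avoid (x : S) (n : ℕ) : MeasurableSet (avoid x n) := by
  obtain ⟨A, hA, h⟩ := exists_avoid_eq_preimage x n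
  rw [h]; exact Preorder.measurable_frestrictLe n hA

theorem setLIntegral_avoid_succ (x : S) (n : ℕ) {g : S → ℝ≥0∞} (hg : Measurable g) :
    ∫⁻ X in avoid x n, g (X (n + 1)) ∂(law κ x) =
      ∫⁻ X in avoid x n, ∫⁻ y, g y ∂(κ (X n)) ∂(law κ x) := by
  obtain ⟨A, hA, h⟩ := exists_avoid_eq_preimage x n
  rw [h]; exact setLIntegral_law_succ κ x n hA hg

theorem measurableSet_visit (x : S) (n : ℕ) : MeasurableSet {X : ℕ → S | X n = x} :=
  (measurable_pi_apply (X := fun _ : ℕ => S) n) (measurableSet_singleton x)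

theorem setLIntegral_avoid_succ_self (x : S) (n : ℕ) {g : S → ℝ≥0∞} (hg : Measurable g) :
    ∫⁻ X in avoid x (n + 1), g (X (n + 1)) ∂(law κ x) =
      ∫⁻ X in avoid x n, ∫⁻ y, ({x}ᶜ : Set S).indicator g y ∂(κ (X n)) ∂(law κ x) := by
  rw [← setLIntegral_avoid_succ κ x n (hg.indicator (measurableSet_singleton x).compl),
    ← lintegral_indicator (measurableSet_avoid x _), ← lintegral_indicator (measurableSet_avoid x _)]
  refine lintegral_congr fun X => ?_
  rw [avoid_succ]
  by_cases h1 : X ∈ avoid x n <;> by_cases h2 : X (n + 1) = x <;> simp [Set.indicator, h1, h2]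

/-- Expected occupation before the return to `x`, weighted by `π {x}`, is bounded by an invariant
measure `π`. -/
theorem mul_sum_setLIntegral_avoid_le (π : Measure S)
    (hπ : ∀ g : S → ℝ≥0∞, Measurable g → ∫⁻ y, ∫⁻ z, g z ∂(κ y) ∂π = ∫⁻ y, g y ∂π) (x : S) (N : ℕ) :
    ∀ g : S → ℝ≥0∞, Measurable g →
      π {x} * ∑ n ∈ Finset.range N, ∫⁻ X in avoid x n, g (X n) ∂(law κ x) ≤ ∫⁻ y, g y ∂π := by
  induction N with
  | zero => intro g _; simp
  | succ N ih =>
    intro g hg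
    have hg' : Measurable (({x}ᶜ : Set S).indicator g) :=
      hg.indicator (measurableSet_singleton x).compl
    -- The term of time `0` is `g x`. By the Markov property the others are those of the induction
    -- hypothesis for the function `g` killed at `x` and averaged over one step; this is why `g` is
    -- quantified inside the induction. Invariance returns `∫ g` off `x`, and `π {x} * g x` supplies
    -- the missing atom.
    rw [Finset.sum_range_succ', mul_add, avoid_zero, Measure.restrict_univ,
      lintegral_law_zero κ x hg]
    simp_rw [setLIntegral_avoid_succ_self κ x _ hg]
    calc _ ≤ ∫⁻ y, ({x}ᶜ : Set S).indicator g y ∂π + π {x} * g x := by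
          gcongr
          exact (ih _ (hg'.lintegral_kernel)).trans (hπ _ hg').le
      _ = ∫⁻ y, g y ∂π := by
          rw [lintegral_indicator (measurableSet_singleton x).compl, add_comm, mul_comm,
            ← lintegral_singleton, lintegral_add_compl _ (measurableSet_singleton x)]

/-- A chain with a finite invariant measure charging every point is positive recurrent. -/
theorem isPositiveRecurrent_of_invariant (π : Measure S) [IsFiniteMeasure π]
    (hpos : ∀ x, π {x} ≠ 0)
    (hπ : ∀ g : S → ℝ≥0∞, Measurable g → ∫⁻ y, ∫⁻ z, g z ∂(κ y) ∂π = ∫⁻ y, g y ∂π) :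
    IsPositiveRecurrent κ := by
  intro x
  have h1 : ∫⁻ X, returnTime x X ∂(law κ x) ≤ ∑' n, law κ x (avoid x n) := by
    refine (lintegral_mono fun X => returnTime_le_tsum x X).trans ?_
    rw [lintegral_tsum fun n =>
      (measurable_one.indicator (measurableSet_avoid x n)).aemeasurable]
    exact ENNReal.tsum_le_tsum fun n => by rw [lintegral_indicator_one (measurableSet_avoid x n)]
  have h2 : π {x} * ∑' n, law κ x (avoid x n) ≤ π Set.univ := by
    rw [ENNReal.tsum_eq_iSup_nat, ENNReal.mul_iSup]
    refine iSup_le fun N => ?_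
    simpa using mul_sum_setLIntegral_avoid_le κ π hπ x N 1 measurable_one
  refine lt_of_le_of_lt h1 ?_
  by_contra h
  rw [not_lt, top_le_iff] at h
  rw [h, ENNReal.mul_top (hpos x), top_le_iff] at h2
  exact measure_ne_top π _ h2

/-- A nonnegative function that is superharmonic off `x`, equal to `1` at `x`, and whose mean after
one step from `x` is less than `1`, bounds the return probability to `x` away from `1`. -/
theorem law_return_lt_one (x : S) (h : S → ℝ≥0∞) (hm : Measurable h) (hx : h x = 1)
    (hsup : ∀ y, y ≠ x → ∫⁻ z, h z ∂(κ y) ≤ h y) (hlt : ∫⁻ z, h z ∂(κ x) < 1) :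
    law κ x {X | ∃ n : ℕ, 1 ≤ n ∧ X n = x} < 1 := by
  -- As `h x = 1`, the quantity on the left is the mean of `h` along the chain stopped at its first
  -- return.
  have hstep : ∀ n, law κ x (avoid x (n + 1))ᶜ +
      ∫⁻ X in avoid x (n + 1), h (X (n + 1)) ∂(law κ x) =
      law κ x (avoid x n)ᶜ + ∫⁻ X in avoid x n, ∫⁻ z, h z ∂(κ (X n)) ∂(law κ x) := by
    intro n
    have hV := measurableSet_visit (S := S) x (n + 1)
    rw [← setLIntegral_avoid_succ κ x n hm,
      ← lintegral_inter_add_sdiff (fun X : ℕ → S => h (X (n + 1))) (avoid x n) hV, ← avoid_succ,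
      ← add_assoc]
    congr 1
    have : ∫⁻ X in avoid x n ∩ {X | X (n + 1) = x}, h (X (n + 1)) ∂(law κ x) =
        law κ x (avoid x n ∩ {X | X (n + 1) = x}) := by
      rw [setLIntegral_congr_fun ((measurableSet_avoid x n).inter hV) (g := fun _ => 1)]
      · simp
      · intro X hX
        simp only
        rw [hX.2, hx]
    rw [this, ← measure_union _ ((measurableSet_avoid x n).inter hV)]
    · congr 1
      rw [avoid_succ]
      ext X
      simp only [Set.mem_compl_iff, Set.mem_sdiff, Set.mem_union, Set.mem_inter_iff]
      tauto
    · exact Set.disjoint_left.2 fun X h1 h2 => h1 h2.1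
  -- The stopped process is a supermartingale only from time `1` on, since nothing is assumed at `x`
  -- beyond the value of the first step.
  have hbound : ∀ n, law κ x (avoid x (n + 1))ᶜ +
      ∫⁻ X in avoid x (n + 1), h (X (n + 1)) ∂(law κ x) ≤ ∫⁻ z, h z ∂(κ x) := by
    intro n
    induction n with
    | zero =>
      rw [hstep, avoid_zero, Measure.restrict_univ, Set.compl_univ, measure_empty, zero_add,
        lintegral_law_zero κ x hm.lintegral_kernel]
    | succ n ih =>
      rw [hstep]
      refine le_trans ?_ ih
      gcongr 1
      refine setLIntegral_mono' (measurableSet_avoid x _) fun X hX => ?_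
      exact hsup _ (hX (n + 1) (by omega) le_rfl)
  have hset : {X : ℕ → S | ∃ n : ℕ, 1 ≤ n ∧ X n = x} = ⋃ n, (avoid x (n + 1))ᶜ := by
    ext X
    simp only [Set.mem_ofPred_eq, Set.mem_iUnion, Set.mem_compl_iff, avoid, not_forall, not_not]
    constructor
    · rintro ⟨n, h1, h2⟩
      exact ⟨n, n, h1, by omega, h2⟩
    · rintro ⟨_, m, h1, _, h2⟩
      exact ⟨m, h1, h2⟩
  have hmono : Monotone fun n => (avoid x (n + 1))ᶜ := fun n m hnm =>
    Set.compl_subset_compl.2 fun X hX k h1 h2 => hX k h1 (by omega)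
  rw [hset, hmono.measure_iUnion]
  exact lt_of_le_of_lt (iSup_le fun n => le_self_add.trans (hbound n)) hlt

end Chain

end MarkovChain

namespace ColouredTree

variable {b : ℕ}

/-! ### Words -/

/-- The vertices of the `n`-th generation. -/
def words (b : ℕ) : ℕ → Finset (Vertex b)
  | 0 => {[]}
  | n + 1 => (words b n ×ˢ Finset.univ).image fun z => z.2 :: z.1

theorem mem_words {n : ℕ} {u : Vertex b} : u ∈ words b n ↔ u.length = n := by
  induction n generalizing u with
  | zero => simp [words]
  | succ n ih =>
    simp only [words, Finset.mem_image, Finset.mem_product, Finset.mem_univ, and_true,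
      Prod.exists]
    constructor
    · rintro ⟨w, j, hw, rfl⟩
      simp [ih.1 hw]
    · intro h
      cases u with
      | nil => simp at h
      | cons j w => exact ⟨w, j, ih.2 (by simpa using h), rfl⟩

theorem sum_words_succ {M : Type*} [AddCommMonoid M] (n : ℕ) (f : Vertex b → M) :
    ∑ u ∈ words b (n + 1), f u = ∑ w ∈ words b n, ∑ j, f (j :: w) := by
  rw [words, Finset.sum_image, Finset.sum_product]
  rintro ⟨w, j⟩ _ ⟨w', j'⟩ _ h
  simp only [List.cons.injEq] at h
  exact Prod.ext h.2 h.1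

theorem sum_words_add {M : Type*} [AddCommMonoid M] (m n : ℕ) (f : Vertex b → M) :
    ∑ u ∈ words b (m + n), f u = ∑ v ∈ words b n, ∑ w ∈ words b m, f (w ++ v) := by
  induction m generalizing f with
  | zero => simp [words]
  | succ m ih =>
    rw [show m + 1 + n = (m + n) + 1 by ring, sum_words_succ, ih]
    simp [sum_words_succ]

theorem tsum_vertex (f : Vertex b → ℝ≥0∞) : ∑' u, f u = ∑' n, ∑ u ∈ words b n, f u := by
  have h1 : ∀ u, f u = ∑' n, if u ∈ words b n then f u else 0 := by
    intro u
    rw [tsum_eq_single u.length]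
    · simp [mem_words]
    · intro n hn
      rw [if_neg]
      rw [mem_words]; exact fun h => hn h.symm
  calc ∑' u, f u = ∑' u, ∑' n, if u ∈ words b n then f u else 0 := tsum_congr h1
    _ = ∑' n, ∑' u, if u ∈ words b n then f u else 0 := ENNReal.tsum_comm
    _ = ∑' n, ∑ u ∈ words b n, f u := by
        refine tsum_congr fun n => ?_
        rw [tsum_eq_sum (s := words b n)]
        · exact Finset.sum_congr rfl fun u hu => if_pos hu
        · exact fun u hu => if_neg hu

/-- Every vertex but the root is a child of exactly one vertex. This reindexing carries the
invariance of the conductance measure. -/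
theorem tsum_vertex_cons (f : Vertex b → ℝ≥0∞) :
    ∑' u, f u = f [] + ∑' u, ∑ j, f (j :: u) := by
  rw [tsum_vertex, tsum_vertex, tsum_eq_zero_add' ENNReal.summable]
  simp only [sum_words_succ]
  simp [words]

/-! ### Environments, shifts and conductances -/

/-- The environment seen from the subtree rooted at `u`. -/
def shift (u : Vertex b) (e : Vertex b → JumpVector b) : Vertex b → JumpVector b :=
  fun w => e (w ++ u)

theorem shift_apply (u : Vertex b) (e : Vertex b → JumpVector b) (w : Vertex b) :
    shift u e w = e (w ++ u) := rfl

theorem shift_shift (u v : Vertex b) (e : Vertex b → JumpVector b) :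
    shift v (shift u e) = shift (v ++ u) e := by
  funext w; simp [shift]

theorem shift_nil (e : Vertex b → JumpVector b) : shift [] e = e := by
  funext w; simp [shift]

theorem measurable_shift (u : Vertex b) : Measurable (shift (b := b) u) :=
  measurable_pi_lambda _ fun _ => measurable_pi_apply _

theorem colour_cons (i j : Fin b) (w : Vertex b) : colour i (j :: w) = j := rfl

theorem colour_append (i : Fin b) (w u : Vertex b) :
    colour i (w ++ u) = colour (colour i u) w := by
  cases w <;> rfl

/-- The conductance of the edge between `u` and its parent, relative to that of the root loop. -/
noncomputable def cond (e : Vertex b → JumpVector b) : Vertex b → ℝ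
  | [] => 1
  | j :: w => cond e w * ratio j (e w)

theorem measurable_coord (a : Option (Fin b)) : Measurable fun q : JumpVector b => q.1 a :=
  (measurable_pi_apply a).comp measurable_subtype_coe

theorem measurable_ratio (j : Fin b) : Measurable (ratio (b := b) j) :=
  (measurable_coord (some j)).div (measurable_coord none)

theorem ratio_pos (j : Fin b) (q : JumpVector b) : 0 < ratio j q :=
  div_pos (q.2.1 _) (q.2.1 _)

theorem cond_pos (e : Vertex b → JumpVector b) (u : Vertex b) : 0 < cond e u := by
  induction u with
  | nil => exact one_pos
  | cons j w ih => exact mul_pos ih (ratio_pos _ _)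

theorem cond_append (e : Vertex b → JumpVector b) (w u : Vertex b) :
    cond e (w ++ u) = cond e u * cond (shift u e) w := by
  induction w with
  | nil => simp [cond]
  | cons j w ih => simp only [List.cons_append, cond, ih, shift_apply]; ring

theorem measurable_cond (u : Vertex b) :
    Measurable fun e : Vertex b → JumpVector b => cond e u := by
  induction u with
  | nil => exact measurable_const
  | cons j w ih => exact ih.mul ((measurable_ratio j).comp (measurable_pi_apply w))

/-- Only strict ancestors of `u` matter. The cruder bound on lengths already separates them from the
subtree rooted at `u`, which is what independence requires. -/
theorem dependsOn_cond (u : Vertex b) :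
    DependsOn (fun e : Vertex b → JumpVector b => cond e u) {w | w.length < u.length} := by
  induction u with
  | nil => intro e e' _; rfl
  | cons j w ih =>
    intro e e' h
    simp only [cond]
    have h1 : cond e w = cond e' w := ih fun v hv => h v (by
      simp only [Set.mem_ofPred_eq, List.length_cons] at hv ⊢; omega)
    rw [h1, h w (by simp)]

/-! ### The law of the environment -/

theorem lintegral_ofReal_rpow_ratio (ν : Fin b → Measure (JumpVector b)) {s : ℝ} (hs : s ∈ momentDomain ν) (i j : Fin b) :
    ∫⁻ q, ENNReal.ofReal (ratio j q ^ s) ∂(ν i) = ENNReal.ofReal (momentMatrix ν s i j) := by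
  rw [momentMatrix, Matrix.of_apply, ofReal_integral_eq_lintegral_ofReal (hs i j)]
  exact Filter.Eventually.of_forall fun q => Real.rpow_nonneg (ratio_pos _ _).le _

theorem momentMatrix_nonneg (ν : Fin b → Measure (JumpVector b)) (s : ℝ) (i j : Fin b) : 0 ≤ momentMatrix ν s i j :=
  integral_nonneg fun _ => Real.rpow_nonneg (ratio_pos _ _).le _

section Law

variable (ν : Fin b → Measure (JumpVector b)) [∀ i, IsProbabilityMeasure (ν i)]

/-- The law of the environment on a tree whose root has colour `i`. -/
noncomputable def envLaw (i : Fin b) : Measure (Vertex b → JumpVector b) :=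
  Measure.infinitePi fun u => ν (colour i u)

instance (i : Fin b) : IsProbabilityMeasure (envLaw ν i) := by
  unfold envLaw; infer_instance

/-- The map `w ↦ w ++ u` is injective and preserves colours once the root is given the colour of
`u`, so the subtree is a fresh copy of the model. -/
theorem map_shift_envLaw (i : Fin b) (u : Vertex b) :
    (envLaw ν i).map (shift u) = envLaw ν (colour i u) := by
  have h := Measure.map_infinitePi_infinitePi_of_inj (P := fun w => ν (colour i w))
    (f := fun w : Vertex b => w ++ u) (fun _ _ h => List.append_cancel_right h)
  simp only [colour_append] at h
  exact h

theorem lintegral_shift (i : Fin b) (u : Vertex b) {g : (Vertex b → JumpVector b) → ℝ≥0∞}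
    (hg : Measurable g) :
    ∫⁻ e, g (shift u e) ∂(envLaw ν i) = ∫⁻ e, g e ∂(envLaw ν (colour i u)) := by
  rw [← map_shift_envLaw, lintegral_map hg (measurable_shift u)]

theorem lintegral_root (i : Fin b) {g : JumpVector b → ℝ≥0∞} (hg : Measurable g) :
    ∫⁻ e, g (e []) ∂(envLaw ν i) = ∫⁻ q, g q ∂(ν i) := by
  have h := Measure.infinitePi_map_eval (fun w => ν (colour i w)) []
  rw [show ν i = ν (colour i []) from rfl, ← h,
    lintegral_map hg (measurable_pi_apply (X := fun _ : Vertex b => JumpVector b) [])]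
  rfl

/-- The subtree rooted at `u` is independent of what lies outside of it. -/
theorem lintegral_mul_shift (i : Fin b) (u : Vertex b)
    {f g : (Vertex b → JumpVector b) → ℝ≥0∞} (hf : Measurable f) (hg : Measurable g)
    (hfd : DependsOn f {w | ¬ u <:+ w}) :
    ∫⁻ e, f e * g (shift u e) ∂(envLaw ν i) =
      (∫⁻ e, f e ∂(envLaw ν i)) * ∫⁻ e, g e ∂(envLaw ν (colour i u)) := by
  classical
  have hind : iIndepFun (fun (w : Vertex b) (e : Vertex b → JumpVector b) => e w) (envLaw ν i) :=
    iIndepFun_infinitePi (P := fun w => ν (colour i w)) (X := fun _ q => q)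
      fun _ => measurable_id
  have hle : ∀ w : Vertex b, MeasurableSpace.comap
      (fun e : Vertex b → JumpVector b => e w) inferInstance ≤ MeasurableSpace.pi := fun w =>
    (measurable_pi_apply w).comap_le
  have hI := indep_iSup_of_disjoint hle hind (S := {w | ¬ u <:+ w}) (T := {w | u <:+ w})
    (Set.disjoint_left.2 fun w h1 h2 => h1 h2)
  rw [← lintegral_shift ν i u hg]
  refine lintegral_mul_eq_lintegral_mul_lintegral_of_independent_measurableSpace
    (iSup₂_le fun w _ => hle w) (iSup₂_le fun w _ => hle w) hI ?_ ?_
  -- Freezing the environment at `q₀` inside the subtree leaves `f` unchanged, which exhibits `f` as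
  -- measurable with respect to the outer coordinates.
  · obtain ⟨q₀⟩ := nonempty_of_isProbabilityMeasure (ν i)
    have : f = f ∘ fun e w => if u <:+ w then q₀ else e w := by
      funext e
      exact hfd fun w hw => (if_neg hw).symm
    rw [this]
    refine hf.comp ?_
    refine @measurable_pi_lambda _ _ _ (_) _ _ fun w => ?_
    by_cases hw : u <:+ w
    · simp only [hw, if_true]; exact measurable_const
    · simp only [hw, if_false]
      exact Measurable.mono (comap_measurable _) (le_iSup₂_of_le w hw le_rfl) le_rfl
  · refine hg.comp ?_
    refine @measurable_pi_lambda _ _ _ (_) _ _ fun w => ?_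
    exact Measurable.mono (comap_measurable _)
      (le_iSup₂_of_le (w ++ u) (List.suffix_append w u) le_rfl) le_rfl

theorem lintegral_cond_cons {s : ℝ} (hs : s ∈ momentDomain ν) (i j : Fin b) (w : Vertex b) :
    ∫⁻ e, ENNReal.ofReal (cond e (j :: w) ^ s) ∂(envLaw ν i) =
      (∫⁻ e, ENNReal.ofReal (cond e w ^ s) ∂(envLaw ν i)) *
        ENNReal.ofReal (momentMatrix ν s (colour i w) j) := by
  have hg : Measurable fun q : JumpVector b => ENNReal.ofReal (ratio j q ^ s) :=
    ((measurable_ratio j).pow_const s).ennreal_ofReal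
  have h := lintegral_mul_shift ν i w (f := fun e => ENNReal.ofReal (cond e w ^ s))
    (g := fun e => ENNReal.ofReal (ratio j (e []) ^ s))
    ((measurable_cond w).pow_const s).ennreal_ofReal
    (hg.comp (measurable_pi_apply (X := fun _ : Vertex b => JumpVector b) [])) (by
      intro e e' h
      simp only
      have hw : cond e w = cond e' w := dependsOn_cond w fun v hv => h v fun hsuf =>
        absurd hsuf.length_le (not_le.2 hv)
      rw [hw])
  rw [lintegral_root ν _ hg, lintegral_ofReal_rpow_ratio ν hs] at h
  rw [← h]
  refine lintegral_congr fun e => ?_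
  simp only [cond, shift_apply, List.nil_append]
  rw [Real.mul_rpow (cond_pos _ _).le (ratio_pos _ _).le,
    ENNReal.ofReal_mul (Real.rpow_nonneg (cond_pos _ _).le _)]

/-- Each new ratio is independent of the conductance above it, and its moment depends only on the
colours at the two ends of the edge. Summing over paths is therefore matrix multiplication. -/
theorem sum_lintegral_cond_eq_pow {s : ℝ} (hs : s ∈ momentDomain ν) (n : ℕ) (i j : Fin b) :
    ∑ w ∈ words b n, (if colour i w = j then
      ∫⁻ e, ENNReal.ofReal (cond e w ^ s) ∂(envLaw ν i) else 0) =
      ENNReal.ofReal ((momentMatrix ν s ^ n) i j) := by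
  have hnn : ∀ n (i j : Fin b), 0 ≤ (momentMatrix ν s ^ n) i j :=
    fun n => Matrix.pow_apply_nonneg (momentMatrix_nonneg ν s) n
  induction n generalizing j with
  | zero => simp [words, colour, cond, Matrix.one_apply]; split_ifs <;> simp
  | succ n ih =>
    rw [sum_words_succ, pow_succ, Matrix.mul_apply, ENNReal.ofReal_sum_of_nonneg fun k _ =>
      mul_nonneg (hnn _ _ _) (momentMatrix_nonneg ν s _ _)]
    simp_rw [ENNReal.ofReal_mul (hnn _ _ _), ← ih, Finset.sum_mul]
    rw [Finset.sum_comm (s := Finset.univ)]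
    refine Finset.sum_congr rfl fun w _ => ?_
    simp only [colour_cons, Finset.sum_ite_eq', Finset.mem_univ, if_true, lintegral_cond_cons ν hs,
      ite_mul, zero_mul, Finset.sum_ite_eq]

end Law

end ColouredTree

/-! ### Matrices with positive entries -/

/-- A matrix with positive entries has a positive eigenvector. -/
theorem Matrix.exists_pos_eigenvector {n : Type*} [Fintype n] [DecidableEq n] [Nonempty n]
    (M : Matrix n n ℝ) (hM : ∀ i j, 0 < M i j) :
    ∃ (t : ℝ) (v : n → ℝ), 0 < t ∧ (∀ i, 0 < v i) ∧ M.mulVec v = t • v := by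
  set T : ℝ := ∑ i, ∑ j, M i j with hT
  have hbound : ∀ (t : ℝ) (x : n → ℝ), x ∈ stdSimplex ℝ n → (∀ i, t * x i ≤ M.mulVec x i) →
      t ≤ T := by
    intro t x hx h
    calc t = ∑ i, t * x i := by rw [← Finset.mul_sum, hx.2, mul_one]
      _ ≤ ∑ i, M.mulVec x i := Finset.sum_le_sum fun i _ => h i
      _ ≤ T := by
        refine Finset.sum_le_sum fun i _ => Finset.sum_le_sum fun j _ => ?_
        have : x j ≤ 1 := hx.2 ▸ Finset.single_le_sum (fun k _ => hx.1 k) (Finset.mem_univ j)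
        exact mul_le_of_le_one_right (hM i j).le this
  have hpos : ∀ x : n → ℝ, (∀ i, 0 ≤ x i) → (∃ i, 0 < x i) → ∀ i, 0 < M.mulVec x i := by
    rintro x hx ⟨j, hj⟩ i
    exact Finset.sum_pos' (fun k _ => mul_nonneg (hM i k).le (hx k))
      ⟨j, Finset.mem_univ j, mul_pos (hM i j) hj⟩
  have hex : ∀ x ∈ stdSimplex ℝ n, ∃ i, 0 < x i := by
    intro x hx
    by_contra! h
    have := hx.2 ▸ Finset.sum_nonpos fun i _ => h i
    exact absurd this (by norm_num)
  -- Collatz–Wielandt: the eigenvalue is the largest `t` for which `t x ≤ M x` is possible on the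
  -- simplex.
  let K : Set (ℝ × (n → ℝ)) :=
    (Set.Icc 0 T ×ˢ stdSimplex ℝ n) ∩ {z | ∀ i, z.1 * z.2 i ≤ M.mulVec z.2 i}
  have hK : IsCompact K := by
    refine (isCompact_Icc.prod (isCompact_stdSimplex ℝ n)).inter_right ?_
    simp only [Set.ofPred_forall]
    refine isClosed_iInter fun i => isClosed_le (by fun_prop) ?_
    simp only [Matrix.mulVec, dotProduct]
    fun_prop
  have hne : K.Nonempty := by
    obtain ⟨x, hx⟩ : (stdSimplex ℝ n).Nonempty :=
      ⟨_, single_mem_stdSimplex ℝ (Classical.arbitrary n)⟩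
    refine ⟨(0, x), ⟨⟨⟨le_rfl, Finset.sum_nonneg fun i _ => Finset.sum_nonneg fun j _ =>
      (hM i j).le⟩, hx⟩, fun i => ?_⟩⟩
    simpa using (hpos x hx.1 (hex x hx) i).le
  obtain ⟨⟨t, x⟩, ⟨⟨⟨ht0, -⟩, hx⟩, htx⟩, hmax⟩ := hK.exists_isMaxOn hne continuous_fst.continuousOn
  simp only at ht0 htx hx
  have hypos := hpos x hx.1 (hex x hx)
  -- Otherwise `M x - t x` is nonnegative and nonzero, so `M` maps it to a strictly positive vector.
  -- The normalisation `z` of `M x` then has slack in every coordinate, and `t` can be increased by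
  -- the smallest slack `ε` since `z i ≤ 1`.
  have heq : M.mulVec x = t • x := by
    by_contra hneq
    have hz : ∃ i, 0 < (M.mulVec x - t • x) i := by
      by_contra! h
      exact hneq (funext fun i => le_antisymm (by simpa using h i) (by simpa using htx i))
    have hd := hpos (M.mulVec x - t • x) (fun i => by simpa using htx i) hz
    set y := M.mulVec x with hy
    set c := ∑ i, y i with hc
    have hcpos : 0 < c := Finset.sum_pos (fun i _ => hypos i) Finset.univ_nonempty
    set z : n → ℝ := c⁻¹ • y with hzdef
    have hzs : z ∈ stdSimplex ℝ n := by
      refine ⟨fun i => mul_nonneg (inv_nonneg.2 hcpos.le) (hypos i).le, ?_⟩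
      simp only [hzdef, Pi.smul_apply, smul_eq_mul, ← Finset.mul_sum]
      exact inv_mul_cancel₀ hcpos.ne'
    have hzd : ∀ i, 0 < M.mulVec z i - t * z i := by
      intro i
      have h1 := hd i
      rw [Matrix.mulVec_sub, Matrix.mulVec_smul] at h1
      have : M.mulVec z i - t * z i = c⁻¹ * ((M.mulVec y - t • M.mulVec x) i) := by
        simp only [hzdef, Matrix.mulVec_smul, Pi.smul_apply, Pi.sub_apply, smul_eq_mul, ← hy]
        ring
      rw [this]
      exact mul_pos (inv_pos.2 hcpos) h1
    obtain ⟨i₀, -, hi₀⟩ := Finset.exists_min_image Finset.univ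
      (fun i => M.mulVec z i - t * z i) Finset.univ_nonempty
    set ε := M.mulVec z i₀ - t * z i₀ with hε
    have hle : ∀ i, (t + ε) * z i ≤ M.mulVec z i := by
      intro i
      have h1 : z i ≤ 1 := hzs.2 ▸ Finset.single_le_sum (fun k _ => hzs.1 k) (Finset.mem_univ i)
      have h2 := hi₀ i (Finset.mem_univ i)
      nlinarith [hzd i₀]
    have hmem : (t + ε, z) ∈ K :=
      ⟨⟨⟨add_nonneg ht0 (hzd i₀).le, hbound _ z hzs hle⟩, hzs⟩, hle⟩
    have := hmax hmem
    simp only [Set.mem_ofPred_eq] at this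
    linarith [hzd i₀]
  have hprod : ∀ i, 0 < t * x i := fun i => by simpa [heq] using hypos i
  have htpos : 0 < t := by
    obtain ⟨i, hi⟩ := hex x hx
    exact pos_of_mul_pos_left (hprod i) hi.le
  exact ⟨t, x, htpos, fun i => pos_of_mul_pos_right (hprod i) ht0, heq⟩

theorem Matrix.pow_mulVec_of_eigenvector {n : Type*} [Fintype n] [DecidableEq n]
    {M : Matrix n n ℝ} {t : ℝ} {v : n → ℝ} (h : M.mulVec v = t • v) (k : ℕ) :
    (M ^ k).mulVec v = t ^ k • v := by
  induction k with
  | zero => simp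
  | succ k ih => rw [pow_succ, ← Matrix.mulVec_mulVec, h, Matrix.mulVec_smul, ih, smul_smul,
      pow_succ, mul_comm]

/-- The entries of the powers are bounded by those of the eigenvalue of a positive eigenvector. -/
theorem Matrix.exists_sum_pow_le {n : Type*} [Fintype n] [DecidableEq n] [Nonempty n]
    {M : Matrix n n ℝ} (hM : ∀ i j, 0 ≤ M i j) {t : ℝ} {v : n → ℝ} (hv : ∀ i, 0 < v i)
    (h : M.mulVec v = t • v) (i : n) :
    ∃ c : ℝ, 0 ≤ c ∧ ∀ k, ∑ j, (M ^ k) i j ≤ c * t ^ k := by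
  have hnn := Matrix.pow_apply_nonneg hM
  obtain ⟨j₀, -, hj₀⟩ := Finset.exists_min_image Finset.univ v Finset.univ_nonempty
  refine ⟨v i / v j₀, (div_pos (hv i) (hv j₀)).le, fun k => ?_⟩
  rw [div_mul_eq_mul_div, le_div_iff₀ (hv j₀), Finset.sum_mul]
  calc ∑ j, (M ^ k) i j * v j₀ ≤ ∑ j, (M ^ k) i j * v j :=
        Finset.sum_le_sum fun j _ => mul_le_mul_of_nonneg_left (hj₀ j (Finset.mem_univ j)) (hnn _ _ _)
    _ = (M ^ k).mulVec v i := rfl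
    _ = v i * t ^ k := by rw [Matrix.pow_mulVec_of_eigenvector h]; simp [mul_comm]

/-! ### Positive recurrence from summable conductances -/

namespace ColouredTree

variable {b : ℕ}

theorem finite_eigenvalues (M : Matrix (Fin b) (Fin b) ℝ) :
    {t : ℝ | Module.End.HasEigenvalue (Matrix.toLin' M) t}.Finite :=
  Module.End.finite_hasEigenvalue _

theorem momentMatrix_pos (ν : Fin b → Measure (JumpVector b)) [∀ i, IsProbabilityMeasure (ν i)]
    {s : ℝ} (hs : s ∈ momentDomain ν) (i j : Fin b) : 0 < momentMatrix ν s i j := by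
  rw [momentMatrix, Matrix.of_apply, integral_pos_iff_support_of_nonneg
    (fun q => Real.rpow_nonneg (ratio_pos _ _).le _) (hs i j)]
  have : (Function.support fun q : JumpVector b => ratio j q ^ s) = Set.univ := by
    ext q
    simp [(Real.rpow_pos_of_pos (ratio_pos j q) s).ne']
  rw [this, measure_univ]
  exact one_pos

theorem sum_ofReal_jump (q : JumpVector b) : ∑ a, ENNReal.ofReal (q.1 a) = 1 := by
  rw [← ENNReal.ofReal_sum_of_nonneg fun a _ => (q.2.1 a).le, q.2.2, ENNReal.ofReal_one]

theorem lintegral_walk (e : Vertex b → JumpVector b) (u : Vertex b) (g : Vertex b → ℝ≥0∞) :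
    ∫⁻ z, g z ∂(walk e u) = ENNReal.ofReal ((e u).1 none) * g u.tail +
      ∑ j, ENNReal.ofReal ((e u).1 (some j)) * g (j :: u) := by
  have : walk e u =
    ∑ a : Option (Fin b), ENNReal.ofReal ((e u).1 a) • Measure.dirac (target u a) := rfl
  rw [this, lintegral_finsetSum_measure, Fintype.sum_option]
  simp only [lintegral_smul_measure, lintegral_dirac, smul_eq_mul, target]

/-- The weights `cond e u / p_{uu*}` of the vertices form an invariant measure of the walk. -/
theorem isPositiveRecurrent_of_tsum_cond (e : Vertex b → JumpVector b)
    (h : ∑' u, ENNReal.ofReal (cond e u) ≠ ∞) : MarkovChain.IsPositiveRecurrent (walk e) := by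
  set p : Vertex b → ℝ≥0∞ := fun u => ENNReal.ofReal (cond e u / (e u).1 none) with hp
  have hnone : ∀ u, p u * ENNReal.ofReal ((e u).1 none) = ENNReal.ofReal (cond e u) := fun u => by
    rw [hp, ← ENNReal.ofReal_mul (div_pos (cond_pos _ _) ((e u).2.1 _)).le,
      div_mul_cancel₀ _ ((e u).2.1 _).ne']
  have hsome : ∀ u j, p u * ENNReal.ofReal ((e u).1 (some j)) = ENNReal.ofReal (cond e (j :: u)) :=
    fun u j => by
      rw [hp, ← ENNReal.ofReal_mul (div_pos (cond_pos _ _) ((e u).2.1 _)).le, cond, ratio]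
      congr 1
      ring
  have hdecomp : ∀ u, p u =
      ENNReal.ofReal (cond e u) + ∑ j, ENNReal.ofReal (cond e (j :: u)) := fun u => by
    calc p u = p u * ∑ a, ENNReal.ofReal ((e u).1 a) := by rw [sum_ofReal_jump, mul_one]
      _ = _ := by
        rw [Fintype.sum_option, mul_add, hnone, Finset.mul_sum]
        simp only [hsome]
  let π : Measure (Vertex b) := Measure.sum fun u => p u • Measure.dirac u
  have hint : ∀ g : Vertex b → ℝ≥0∞, ∫⁻ y, g y ∂π = ∑' u, p u * g u := fun g => by
    simp [π, lintegral_sum_measure]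
  have hfin : IsFiniteMeasure π := by
    constructor
    rw [← lintegral_one, hint]
    simp only [mul_one, hdecomp]
    rw [ENNReal.tsum_add]
    refine ENNReal.add_lt_top.2 ⟨h.lt_top, lt_of_le_of_lt ?_ h.lt_top⟩
    rw [tsum_vertex_cons fun u => ENNReal.ofReal (cond e u)]
    exact le_add_self
  refine MarkovChain.isPositiveRecurrent_of_invariant (walk e) π (fun x => ?_) fun g _ => ?_
  · rw [← lintegral_indicator_one (measurableSet_singleton x), hint]
    refine (lt_of_lt_of_le ?_ (ENNReal.le_tsum x)).ne'
    simp only [Set.mem_singleton_iff, Set.indicator_of_mem, Pi.one_apply, mul_one, hp]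
    exact ENNReal.ofReal_pos.2 (div_pos (cond_pos _ _) ((e x).2.1 _))
  -- Detailed balance: both sides weigh every edge at its two ends. Since `[].tail = []`, the loop
  -- at the root, of conductance `1`, accounts for the boundary term.
  · have hwalk : ∀ u, p u * ∫⁻ z, g z ∂(walk e u) =
        ENNReal.ofReal (cond e u) * g u.tail +
          ∑ j, ENNReal.ofReal (cond e (j :: u)) * g (j :: u) := fun u => by
      rw [lintegral_walk, mul_add, ← mul_assoc, hnone, Finset.mul_sum]
      simp only [← mul_assoc, hsome]
    rw [hint, hint]
    simp only [hwalk]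
    simp only [hdecomp, add_mul]
    rw [ENNReal.tsum_add, ENNReal.tsum_add,
      tsum_vertex_cons fun u => ENNReal.ofReal (cond e u) * g u.tail,
      tsum_vertex_cons fun u => ENNReal.ofReal (cond e u) * g u]
    simp only [List.tail_nil, List.tail_cons, Finset.sum_mul]
    ring

/-- If some `ρ(s) < 1`, then almost surely the conductances are summable. -/
theorem ae_tsum_cond_ne_top (ν : Fin b → Measure (JumpVector b)) [∀ i, IsProbabilityMeasure (ν i)]
    {s : ℝ} (hs0 : 0 ≤ s) (hs1 : s ≤ 1) (hs : s ∈ momentDomain ν) (hrho : rho ν s < 1)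
    (c₀ : Fin b) :
    ∀ᵐ e ∂(envLaw ν c₀), ∑' u, ENNReal.ofReal (cond e u) ≠ ∞ := by
  have : Nonempty (Fin b) := ⟨c₀⟩
  obtain ⟨t, v, ht, hv, htv⟩ := (momentMatrix ν s).exists_pos_eigenvector (momentMatrix_pos ν hs)
  have ht1 : t < 1 := by
    refine lt_of_le_of_lt (le_csSup (finite_eigenvalues _).bddAbove ?_) hrho
    refine Module.End.hasEigenvalue_of_hasEigenvector (x := v) ⟨?_, ?_⟩
    · rw [Module.End.mem_eigenspace_iff, Matrix.toLin'_apply, htv]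
    · intro h0
      have := hv c₀
      simp [h0] at this
  obtain ⟨c, hc, hle⟩ := Matrix.exists_sum_pow_le (fun i j => (momentMatrix_pos ν hs i j).le) hv htv
    c₀
  have hnn : ∀ n j, 0 ≤ (momentMatrix ν s ^ n) c₀ j :=
    fun n => Matrix.pow_apply_nonneg (momentMatrix_nonneg ν s) n c₀
  have hmeas : ∀ u : Vertex b, Measurable fun e : Vertex b → JumpVector b =>
      ENNReal.ofReal (cond e u ^ s) := fun u => ((measurable_cond u).pow_const s).ennreal_ofReal
  have hfin : ∫⁻ e, ∑' u, ENNReal.ofReal (cond e u ^ s) ∂(envLaw ν c₀) ≠ ∞ := by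
    rw [lintegral_tsum fun u => (hmeas u).aemeasurable, tsum_vertex]
    have h1 : ∀ n, ∑ w ∈ words b n, ∫⁻ e, ENNReal.ofReal (cond e w ^ s) ∂(envLaw ν c₀) ≤
        ENNReal.ofReal (c * t ^ n) := fun n => by
      calc _ = ∑ j, ∑ w ∈ words b n, (if colour c₀ w = j then
            ∫⁻ e, ENNReal.ofReal (cond e w ^ s) ∂(envLaw ν c₀) else 0) := by
            rw [Finset.sum_comm]
            simp
        _ = ENNReal.ofReal (∑ j, (momentMatrix ν s ^ n) c₀ j) := by
            rw [ENNReal.ofReal_sum_of_nonneg fun j _ => hnn n j]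
            exact Finset.sum_congr rfl fun j _ => sum_lintegral_cond_eq_pow ν hs n c₀ j
        _ ≤ _ := ENNReal.ofReal_le_ofReal (hle n)
    refine ne_top_of_le_ne_top ?_ (ENNReal.tsum_le_tsum h1)
    exact ((summable_geometric_of_lt_one ht.le ht1).mul_left c).tsum_ofReal_ne_top
  filter_upwards [ae_lt_top' (AEMeasurable.tsum fun u => (hmeas u).aemeasurable) hfin]
    with e he
  have hsum : Summable fun u => cond e u ^ s := by
    have := ENNReal.summable_toReal he.ne
    simpa only [ENNReal.toReal_ofReal (Real.rpow_nonneg (cond_pos e _).le s)] using this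
  -- All but finitely many terms are below `1`, and there `s ≤ 1` gives `cond ≤ cond ^ s`.
  have hcof := hsum.tendsto_cofinite_zero.eventually_lt_const one_pos
  refine (Summable.tsum_ofReal_ne_top ?_)
  refine Summable.of_norm_bounded_eventually hsum ?_
  filter_upwards [hcof] with u hu
  have hc1 : cond e u < 1 := by
    by_contra! h
    exact absurd hu (not_lt.2 (Real.one_le_rpow h hs0))
  rw [Real.norm_of_nonneg (cond_pos e u).le]
  calc cond e u = cond e u ^ (1 : ℝ) := (Real.rpow_one _).symm
    _ ≤ cond e u ^ s := Real.rpow_le_rpow_of_exponent_ge (cond_pos e u) hc1.le hs1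

end ColouredTree

/-! ### Exponential growth of the number of large products -/

/-- A positive function on `(0, 1)` bounded away from `0` satisfies a strict inequality between its
values and its derivative, at some point. -/
theorem exists_lt_sub_mul_deriv_add_min {f f' : ℝ → ℝ} {ε : ℝ} (hε : 0 < ε)
    (hf : ∀ s ∈ Set.Ioo (0 : ℝ) 1, HasDerivAt f (f' s) s) (hpos : ∀ s ∈ Set.Ioo (0 : ℝ) 1, ε ≤ f s) :
    ∃ s ∈ Set.Ioo (0 : ℝ) 1, 0 < f s - s * f' s + min (f' s) 0 := by
  have hhalf : (1 / 2 : ℝ) ∈ Set.Ioo (0 : ℝ) 1 := by norm_num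
  have hf2 := hpos _ hhalf
  set F := f (1 / 2) with hF
  -- Small enough that `ε / τ = 4 * F` exceeds `2 * F`, the value at `1 / 2` of both `f s / (1 - s)`
  -- and `f s / s`. Each quotient thus increases strictly from `1 / 2` towards its pole, and the
  -- mean value theorem gives `s₁` and `s₂`.
  set τ := ε / (4 * F) with hτ
  have hFpos : 0 < F := hε.trans_le hf2
  have hτ0 : 0 < τ := by positivity
  have hτ1 : τ ≤ 1 / 4 := by
    rw [hτ, div_le_iff₀ (by positivity)]; linarith
  have hτF : τ * F = ε / 4 := by rw [hτ]; field_simp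
  obtain ⟨s₁, hs₁, h₁⟩ : ∃ s ∈ Set.Ioo (0 : ℝ) 1, 0 < f s + (1 - s) * f' s := by
    have hder : ∀ s ∈ Set.Ioo (0 : ℝ) 1,
        HasDerivAt (fun s => f s / (1 - s)) ((f' s * (1 - s) - f s * (-1)) / (1 - s) ^ 2) s :=
      fun s hs => (hf s hs).div ((hasDerivAt_id s).const_sub 1) (sub_pos.2 hs.2).ne'
    obtain ⟨s, hs, h⟩ := exists_hasDerivAt_eq_slope (fun s => f s / (1 - s))
      (fun s => (f' s * (1 - s) - f s * (-1)) / (1 - s) ^ 2) (a := 1 / 2) (b := 1 - τ)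
      (by linarith) (fun s hs => (hder s ⟨by linarith [hs.1], by linarith [hs.2]⟩
        ).continuousAt.continuousWithinAt)
      (fun s hs => hder s ⟨by linarith [hs.1], by linarith [hs.2]⟩)
    refine ⟨s, ⟨by linarith [hs.1], by linarith [hs.2]⟩, ?_⟩
    have hright : 0 < (f (1 - τ) / (1 - (1 - τ)) - f (1 / 2) / (1 - 1 / 2)) / (1 - τ - 1 / 2) := by
      refine div_pos ?_ (by linarith)
      have h3 := hpos (1 - τ) ⟨by linarith, by linarith⟩
      rw [← hF, sub_sub_cancel, sub_pos, div_lt_div_iff₀ (by norm_num) hτ0]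
      nlinarith
    rw [← h] at hright
    have h1s : 0 < 1 - s := by linarith [hs.2]
    have := (div_pos_iff_of_pos_right (pow_pos h1s 2)).1 hright
    linarith
  obtain ⟨s₂, hs₂, h₂⟩ : ∃ s ∈ Set.Ioo (0 : ℝ) 1, 0 < f s - s * f' s := by
    have hder : ∀ s ∈ Set.Ioo (0 : ℝ) 1,
        HasDerivAt (fun s => f s / s) ((f' s * s - f s * 1) / s ^ 2) s :=
      fun s hs => (hf s hs).div (hasDerivAt_id s) hs.1.ne'
    obtain ⟨s, hs, h⟩ := exists_hasDerivAt_eq_slope (fun s => f s / s)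
      (fun s => (f' s * s - f s * 1) / s ^ 2) (a := τ) (b := 1 / 2)
      (by linarith) (fun s hs => (hder s ⟨by linarith [hs.1], by linarith [hs.2]⟩
        ).continuousAt.continuousWithinAt)
      (fun s hs => hder s ⟨by linarith [hs.1], by linarith [hs.2]⟩)
    refine ⟨s, ⟨by linarith [hs.1], by linarith [hs.2]⟩, ?_⟩
    have hright : 0 < -((f (1 / 2) / (1 / 2) - f τ / τ) / (1 / 2 - τ)) := by
      rw [← neg_div]
      refine div_pos ?_ (by linarith)
      have h3 := hpos τ ⟨by linarith, by linarith⟩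
      rw [← hF, neg_sub, sub_pos, div_lt_div_iff₀ (by norm_num) hτ0]
      nlinarith
    rw [← h, ← neg_div] at hright
    have h1s : 0 < s := by linarith [hs.1]
    have := (div_pos_iff_of_pos_right (pow_pos h1s 2)).1 hright
    linarith
  -- If `f' s₁ ≤ 0` or `f' s₂ ≥ 0`, that point serves. Otherwise `f'` changes sign and Darboux's
  -- theorem gives a zero of `f'`, where the expression is just `f s`.
  rcases le_or_gt (f' s₁) 0 with h1 | h1
  · exact ⟨s₁, hs₁, by rw [min_eq_left h1]; linarith⟩
  rcases le_or_gt 0 (f' s₂) with h2 | h2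
  · exact ⟨s₂, hs₂, by rw [min_eq_right h2]; linarith⟩
  have hconn := Set.ordConnected_Ioo.image_hasDerivWithinAt
    (fun s hs => (hf s hs).hasDerivWithinAt (s := Set.Ioo (0 : ℝ) 1))
  obtain ⟨s, hs, h⟩ := hconn.out (Set.mem_image_of_mem f' hs₂) (Set.mem_image_of_mem f' hs₁)
    ⟨h2.le, h1.le⟩
  exact ⟨s, hs, by rw [h]; simpa using hε.trans_le (hpos s hs)⟩

/-- If the exponential moments of order `s ∈ (0, 1)` of the measures `η k` are the powers of a
function `exp ∘ f` which is bounded away from `1`, some `η k` gives mass more than `exp (-z)` to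
`[z, ∞)`, for some `z ≤ 0`. -/
theorem exists_exp_neg_lt_measure_Ici (η : ℕ → Measure ℝ) {f f' : ℝ → ℝ} {ε : ℝ} (hε : 0 < ε)
    (hf : ∀ s ∈ Set.Ioo (0 : ℝ) 1, HasDerivAt f (f' s) s) (hpos : ∀ s ∈ Set.Ioo (0 : ℝ) 1, ε ≤ f s)
    (hη : ∀ k : ℕ, ∀ s ∈ Set.Ioo (0 : ℝ) 1,
      ∫⁻ x, ENNReal.ofReal (Real.exp (s * x)) ∂(η k) = ENNReal.ofReal (Real.exp (k * f s))) :
    ∃ (k : ℕ) (z : ℝ), z ≤ 0 ∧ ENNReal.ofReal (Real.exp (-z)) < η k (Set.Ici z) := by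
  -- Tilting by `s` concentrates `η k` near `d * k`, with `d = f' s`, where its mass is of order
  -- `exp (k * (f s - s * d))`. Positivity of `G` says that this beats `exp (-(k * min d 0))`.
  obtain ⟨s, hs, hG⟩ := exists_lt_sub_mul_deriv_add_min hε hf hpos
  set d := f' s with hd
  set a := min d 0 with ha
  set G := f s - s * d + a with hGdef
  set δ := G / 4 with hδ
  have hδ0 : 0 < δ := by positivity
  have had : a ≤ d := min_le_left _ _
  have ha0 : a ≤ 0 := min_le_right _ _
  obtain ⟨t, ht0, htp, htm, hbp, hbm⟩ : ∃ t : ℝ, 0 < t ∧ s + t ∈ Set.Ioo (0 : ℝ) 1 ∧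
      s - t ∈ Set.Ioo (0 : ℝ) 1 ∧ f (s + t) ≤ f s + t * d + δ / 2 * t ∧
      f (s - t) ≤ f s - t * d + δ / 2 * t := by
    have h1 := (hasDerivAt_iff_isLittleO.1 (hf s hs)).def (half_pos hδ0)
    have h2 := h1.and (isOpen_Ioo.mem_nhds hs)
    obtain ⟨r, hr, h⟩ := Metric.eventually_nhds_iff.1 h2
    have hp := @h (s + r / 2) (by simp [abs_of_pos hr]; linarith)
    have hm := @h (s - r / 2) (by simp [abs_of_pos hr]; linarith)
    refine ⟨r / 2, by positivity, hp.2, hm.2, ?_, ?_⟩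
    · have := hp.1
      rw [add_sub_cancel_left, Real.norm_eq_abs, Real.norm_eq_abs, abs_of_pos (half_pos hr),
        smul_eq_mul] at this
      linarith [(abs_le.1 this).2]
    · have := hm.1
      rw [sub_sub_cancel_left, Real.norm_eq_abs, Real.norm_eq_abs, abs_neg,
        abs_of_pos (half_pos hr), smul_eq_mul] at this
      linarith [(abs_le.1 this).2]
  -- The exponential gain in each of the three parts of the line: `G / 2` for the window of radius
  -- `δ * k` around `d * k`, and `δ * t / 2` for each tail.
  set κ := min (G / 2) (δ * t / 2) with hκ
  have hκ0 : 0 < κ := lt_min (by positivity) (by positivity)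
  obtain ⟨k, hk⟩ := exists_nat_gt (3 / κ)
  rw [div_lt_iff₀ hκ0] at hk
  set z := (a - δ) * k with hz
  have hk0 : (0 : ℝ) ≤ k := Nat.cast_nonneg k
  refine ⟨k, z, mul_nonpos_of_nonpos_of_nonneg (by linarith) hk0, ?_⟩
  by_contra! hcon
  -- Beyond the window, on the right or the left, `exp (s * x)` is dominated by a multiple of the
  -- exponential of order `s + t` or `s - t`. The window itself lies in `[z, ∞)`, because `a ≤ d`.
  have hpt : ∀ x : ℝ, ENNReal.ofReal (Real.exp (s * x)) ≤
      ENNReal.ofReal (Real.exp (s * (d + δ) * k)) * (Set.Ici z).indicator 1 x +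
      (ENNReal.ofReal (Real.exp (-(t * (d + δ) * k))) * ENNReal.ofReal (Real.exp ((s + t) * x)) +
      ENNReal.ofReal (Real.exp (t * (d - δ) * k)) * ENNReal.ofReal (Real.exp ((s - t) * x))) := by
    intro x
    simp only [← ENNReal.ofReal_mul (Real.exp_pos _).le, ← Real.exp_add]
    rcases lt_or_ge ((d + δ) * k) x with h | h
    · refine le_add_of_nonneg_of_le zero_le (le_add_of_le_of_nonneg ?_ zero_le)
      refine ENNReal.ofReal_le_ofReal (Real.exp_le_exp.2 ?_)
      nlinarith
    rcases lt_or_ge x ((d - δ) * k) with h' | h'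
    · refine le_add_of_nonneg_of_le zero_le (le_add_of_nonneg_of_le zero_le ?_)
      refine ENNReal.ofReal_le_ofReal (Real.exp_le_exp.2 ?_)
      nlinarith
    · refine le_add_of_le_of_nonneg ?_ zero_le
      have : x ∈ Set.Ici z := le_trans (mul_le_mul_of_nonneg_right (by linarith) hk0) h'
      rw [Set.indicator_of_mem this, Pi.one_apply, mul_one]
      refine ENNReal.ofReal_le_ofReal (Real.exp_le_exp.2 ?_)
      nlinarith [mul_le_mul_of_nonneg_left h hs.1.le]
  have hm : ∀ r : ℝ, Measurable fun x : ℝ => ENNReal.ofReal (Real.exp (r * x)) := fun r => by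
    fun_prop
  have hint := lintegral_mono (μ := η k) hpt
  rw [lintegral_add_left ((measurable_one.indicator measurableSet_Ici).const_mul _),
    lintegral_add_left ((hm _).const_mul _), lintegral_const_mul _ (hm _),
    lintegral_const_mul _ (hm _), lintegral_const_mul _ (measurable_one.indicator measurableSet_Ici),
    lintegral_indicator_one measurableSet_Ici, hη k s hs, hη k _ htp, hη k _ htm] at hint
  have hint2 := hint.trans (add_le_add_left (mul_le_mul_right hcon _) _)
  simp only [← ENNReal.ofReal_mul (Real.exp_pos _).le, ← Real.exp_add] at hint2
  rw [← ENNReal.ofReal_add (Real.exp_pos _).le (Real.exp_pos _).le,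
    ← ENNReal.ofReal_add (Real.exp_pos _).le (by positivity),
    ENNReal.ofReal_le_ofReal_iff (by positivity)] at hint2
  have hκ1 : κ ≤ G / 2 := min_le_left _ _
  have hκ2 : κ ≤ δ * t / 2 := min_le_right _ _
  have e1 : s * (d + δ) * k + -z ≤ k * (f s - κ) := by
    have : s * (d + δ) - (a - δ) ≤ f s - κ := by nlinarith [hs.2]
    nlinarith [mul_le_mul_of_nonneg_left this hk0]
  have e2 : -(t * (d + δ) * k) + k * f (s + t) ≤ k * (f s - κ) := by
    have : -(t * (d + δ)) + f (s + t) ≤ f s - κ := by nlinarith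
    nlinarith [mul_le_mul_of_nonneg_left this hk0]
  have e3 : t * (d - δ) * k + k * f (s - t) ≤ k * (f s - κ) := by
    have : t * (d - δ) + f (s - t) ≤ f s - κ := by nlinarith
    nlinarith [mul_le_mul_of_nonneg_left this hk0]
  -- This forces `exp (k * κ) ≤ 3`, against the choice `k * κ > 3`.
  have h3 : Real.exp (k * f s) ≤ 3 * Real.exp (k * (f s - κ)) := by
    linarith [Real.exp_le_exp.2 e1, Real.exp_le_exp.2 e2, Real.exp_le_exp.2 e3]
  have h4 : Real.exp (k * f s) = Real.exp (k * κ) * Real.exp (k * (f s - κ)) := by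
    rw [← Real.exp_add]; congr 1; ring
  rw [h4] at h3
  have h5 := le_of_mul_le_mul_right h3 (Real.exp_pos _)
  linarith [Real.add_one_le_exp (k * κ)]

/-- Lower bound on the diagonal entries of the powers of a matrix with entries at least `a > 0`, in
terms of an eigenvalue `t`. -/
theorem Matrix.le_pow_add_two_diag {n : Type*} [Fintype n] [DecidableEq n] {M : Matrix n n ℝ}
    {a t : ℝ} (ha : 0 ≤ a) (hM : ∀ i j, a ≤ M i j) (ht : 0 ≤ t) {w : n → ℝ} (hw : w ≠ 0)
    (h : M.mulVec w = t • w) (k : ℕ) (i : n) :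
    a ^ 2 * (t ^ k / Fintype.card n) ≤ (M ^ (k + 2)) i i := by
  have hM0 : ∀ i j, 0 ≤ M i j := fun i j => ha.trans (hM i j)
  have : Nonempty n := ⟨i⟩
  -- The eigenvector may change sign; at a coordinate of largest modulus it still bounds the row sum
  -- of `M ^ k` below by `t ^ k`. Some entry of that row is at least the average, and one extra step
  -- at each end, costing a factor `a`, closes the path into a loop at `i`.
  obtain ⟨i₀, -, hi₀⟩ := Finset.exists_max_image Finset.univ (fun i => |w i|) Finset.univ_nonempty
  have hpos : 0 < |w i₀| := by
    obtain ⟨j, hj⟩ := Function.ne_iff.1 hw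
    exact (abs_pos.2 hj).trans_le (hi₀ j (Finset.mem_univ j))
  have hsum : t ^ k ≤ ∑ j, (M ^ k) i₀ j := by
    refine le_of_mul_le_mul_right ?_ hpos
    calc t ^ k * |w i₀| = |(M ^ k).mulVec w i₀| := by
          rw [Matrix.pow_mulVec_of_eigenvector h, Pi.smul_apply, smul_eq_mul, abs_mul,
            abs_of_nonneg (pow_nonneg ht k)]
      _ ≤ ∑ j, |(M ^ k) i₀ j * w j| := Finset.abs_sum_le_sum_abs _ _
      _ ≤ ∑ j, (M ^ k) i₀ j * |w i₀| := Finset.sum_le_sum fun j _ => by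
          rw [abs_mul, abs_of_nonneg (Matrix.pow_apply_nonneg hM0 k _ _)]
          exact mul_le_mul_of_nonneg_left (hi₀ j (Finset.mem_univ j))
            (Matrix.pow_apply_nonneg hM0 k _ _)
      _ = _ := by rw [Finset.sum_mul]
  obtain ⟨j, -, hj⟩ := Finset.exists_le_of_sum_le (s := Finset.univ)
    (f := fun _ : n => t ^ k / Fintype.card n) (g := fun j => (M ^ k) i₀ j)
    Finset.univ_nonempty (by
      rw [Finset.sum_const, Finset.card_univ, nsmul_eq_mul, mul_div_cancel₀]
      · exact hsum
      · exact_mod_cast Fintype.card_ne_zero)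
  have h1 : (M ^ k) i₀ j * M j i ≤ (M ^ (k + 1)) i₀ i := by
    rw [pow_succ, Matrix.mul_apply]
    exact Finset.single_le_sum (f := fun l => (M ^ k) i₀ l * M l i)
      (fun l _ => mul_nonneg (Matrix.pow_apply_nonneg hM0 k _ _) (hM0 _ _)) (Finset.mem_univ j)
  have h2 : M i i₀ * (M ^ (k + 1)) i₀ i ≤ (M ^ (k + 2)) i i := by
    rw [pow_succ' M (k + 1), Matrix.mul_apply]
    exact Finset.single_le_sum (f := fun l => M i l * (M ^ (k + 1)) l i)
      (fun l _ => mul_nonneg (hM0 _ _) (Matrix.pow_apply_nonneg hM0 _ _ _)) (Finset.mem_univ i₀)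
  have hq : 0 ≤ t ^ k / (Fintype.card n : ℝ) := by positivity
  calc a ^ 2 * (t ^ k / Fintype.card n) = a * (t ^ k / Fintype.card n * a) := by ring
    _ ≤ M i i₀ * ((M ^ k) i₀ j * M j i) :=
        mul_le_mul (hM _ _) (mul_le_mul hj (hM _ _) ha (hq.trans hj)) (mul_nonneg hq ha) (hM0 _ _)
    _ ≤ M i i₀ * (M ^ (k + 1)) i₀ i := mul_le_mul_of_nonneg_left h1 (hM0 _ _)
    _ ≤ _ := h2

/-! ### Spectral bounds and the mean number of vertices of large conductance -/

namespace ColouredTree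

variable {b : ℕ}

section Spectral

variable (ν : Fin b → Measure (JumpVector b)) [∀ i, IsProbabilityMeasure (ν i)]

/-- `ρ(s)` is an eigenvalue, and it is positive. -/
theorem hasEigenvalue_rho [Nonempty (Fin b)] {s : ℝ} (hs : s ∈ momentDomain ν) :
    0 < rho ν s ∧ Module.End.HasEigenvalue (Matrix.toLin' (momentMatrix ν s)) (rho ν s) := by
  obtain ⟨t, v, ht, hv, htv⟩ := (momentMatrix ν s).exists_pos_eigenvector (momentMatrix_pos ν hs)
  have hmem : t ∈ {t : ℝ | Module.End.HasEigenvalue (Matrix.toLin' (momentMatrix ν s)) t} := by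
    refine Module.End.hasEigenvalue_of_hasEigenvector (x := v) ⟨?_, ?_⟩
    · rw [Module.End.mem_eigenspace_iff, Matrix.toLin'_apply, htv]
    · intro h0
      have := hv (Classical.arbitrary _)
      simp [h0] at this
  exact ⟨ht.trans_le (le_csSup (finite_eigenvalues _).bddAbove hmem),
    Set.Nonempty.csSup_mem ⟨t, hmem⟩ (finite_eigenvalues _)⟩

theorem lambdaOne_le_rho [Nonempty (Fin b)] (hD : Set.Icc 0 1 ⊆ momentDomain ν) {s : ℝ}
    (hs : s ∈ Set.Icc (0 : ℝ) 1) : lambdaOne ν ≤ rho ν s := by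
  refine csInf_le ⟨0, ?_⟩ (Set.mem_image_of_mem _ hs)
  rintro _ ⟨s, hs, rfl⟩
  exact (hasEigenvalue_rho ν (hD hs)).1.le

/-- For `s ∈ [0, 1]` one has `x ^ s ≥ min 1 x`, whose mean is positive and does not involve `s`. -/
theorem exists_pos_le_momentMatrix [Nonempty (Fin b)] (hD : Set.Icc 0 1 ⊆ momentDomain ν) :
    ∃ a : ℝ, 0 < a ∧ ∀ s ∈ Set.Icc (0 : ℝ) 1, ∀ i j, a ≤ momentMatrix ν s i j := by
  have hint : ∀ i j, Integrable (fun q : JumpVector b => min 1 (ratio j q)) (ν i) := fun i j => by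
    refine Integrable.mono' (integrable_const 1)
      ((measurable_const.min (measurable_ratio j)).aestronglyMeasurable)
      (Filter.Eventually.of_forall fun q => ?_)
    rw [Real.norm_of_nonneg (le_min zero_le_one (ratio_pos j q).le)]
    exact min_le_left _ _
  have hpos : ∀ i j, 0 < ∫ q, min 1 (ratio j q) ∂(ν i) := fun i j => by
    rw [integral_pos_iff_support_of_nonneg
      (fun q => le_min zero_le_one (ratio_pos j q).le) (hint i j)]
    have : (Function.support fun q : JumpVector b => min 1 (ratio j q)) = Set.univ := by
      ext q
      simp only [Function.mem_support, Set.mem_univ, iff_true]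
      exact (lt_min one_pos (ratio_pos j q)).ne'
    rw [this, measure_univ]
    exact one_pos
  obtain ⟨z, -, hz⟩ := Finset.exists_min_image (Finset.univ : Finset (Fin b × Fin b))
    (fun z => ∫ q, min 1 (ratio z.2 q) ∂(ν z.1)) Finset.univ_nonempty
  refine ⟨_, hpos z.1 z.2, fun s hs i j => (hz (i, j) (Finset.mem_univ _)).trans ?_⟩
  refine integral_mono (hint i j) (hD hs i j) fun q => ?_
  have hq := ratio_pos j q
  rcases le_or_gt 1 (ratio j q) with h | h
  · exact (min_le_left _ _).trans (Real.one_le_rpow h hs.1)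
  · refine (min_le_right _ _).trans ?_
    calc ratio j q = ratio j q ^ (1 : ℝ) := (Real.rpow_one _).symm
      _ ≤ _ := Real.rpow_le_rpow_of_exponent_ge hq h.le hs.2

/-- The exponent is uniform in `s`, since `ρ(s) ≥ λ₁ > 1` and the entries have a common lower bound.
It keeps the logarithm of the diagonal entry above `log 2` up to the ends of `(0, 1)`. -/
theorem exists_two_le_pow_momentMatrix [Nonempty (Fin b)] (hD : Set.Icc 0 1 ⊆ momentDomain ν)
    (hl : 1 < lambdaOne ν) (i : Fin b) :
    ∃ N, ∀ s ∈ Set.Icc (0 : ℝ) 1, 2 ≤ (momentMatrix ν s ^ N) i i := by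
  obtain ⟨a, ha, hle⟩ := exists_pos_le_momentMatrix ν hD
  have hb : (0 : ℝ) < Fintype.card (Fin b) := by exact_mod_cast Fintype.card_pos
  obtain ⟨k, hk⟩ := pow_unbounded_of_one_lt (2 * Fintype.card (Fin b) / a ^ 2) hl
  refine ⟨k + 2, fun s hs => ?_⟩
  obtain ⟨hr, hev⟩ := hasEigenvalue_rho ν (hD hs)
  obtain ⟨w, hw⟩ := hev.exists_hasEigenvector
  have h := Matrix.le_pow_add_two_diag ha.le (hle s hs) hr.le hw.2
    (by simpa [Module.End.mem_eigenspace_iff] using hw.1) k i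
  refine le_trans ?_ h
  have h1 : lambdaOne ν ^ k ≤ rho ν s ^ k :=
    pow_le_pow_left₀ (by linarith) (lambdaOne_le_rho ν hD hs) k
  have h2 := hk.le.trans h1
  rw [div_le_iff₀ (by positivity)] at h2
  rw [← mul_div_assoc, le_div_iff₀ hb]
  linarith

end Spectral

/-- Each entry is the moment generating function of `log ξ̄`, differentiable in the interior of its
domain. -/
theorem differentiableAt_momentMatrix (ν : Fin b → Measure (JumpVector b))
    (hD : Set.Icc 0 1 ⊆ momentDomain ν) {s : ℝ} (hs : s ∈ Set.Ioo (0 : ℝ) 1) (i j : Fin b) :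
    DifferentiableAt ℝ (fun s => momentMatrix ν s i j) s := by
  have hexp : ∀ (s : ℝ) (q : JumpVector b), ratio j q ^ s = Real.exp (s * Real.log (ratio j q)) :=
    fun s q => by rw [Real.rpow_def_of_pos (ratio_pos j q), mul_comm]
  have h1 : (fun s => momentMatrix ν s i j) = mgf (fun q => Real.log (ratio j q)) (ν i) := by
    funext s
    simp only [momentMatrix, Matrix.of_apply, mgf, hexp]
  rw [h1]
  refine differentiableAt_mgf ?_
  refine interior_maximal (fun t ht => ?_) isOpen_Ioo hs
  have := hD ⟨ht.1.le, ht.2.le⟩ i j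
  simp only [hexp] at this
  exact this

theorem differentiableAt_pow_momentMatrix (ν : Fin b → Measure (JumpVector b))
    (hD : Set.Icc 0 1 ⊆ momentDomain ν) {s : ℝ} (hs : s ∈ Set.Ioo (0 : ℝ) 1) (n : ℕ)
    (i j : Fin b) : DifferentiableAt ℝ (fun s => (momentMatrix ν s ^ n) i j) s := by
  induction n generalizing j with
  | zero => simp
  | succ n ih =>
    simp only [pow_succ, Matrix.mul_apply]
    exact DifferentiableAt.fun_sum fun l _ => (ih l).mul (differentiableAt_momentMatrix ν hD hs l j)

/-- The words made of `k` blocks of `n` letters, each ending at a vertex of colour `i`. -/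
def blockWords (i : Fin b) (n : ℕ) : ℕ → Finset (Vertex b)
  | 0 => {[]}
  | k + 1 => (((words b n).filter fun v => colour i v = i) ×ˢ blockWords i n k).image
      fun z => z.2 ++ z.1

theorem sum_blockWords_succ {M : Type*} [AddCommMonoid M] (i : Fin b) (n k : ℕ)
    (f : Vertex b → M) :
    ∑ u ∈ blockWords i n (k + 1), f u =
      ∑ v ∈ (words b n).filter (fun v => colour i v = i), ∑ w ∈ blockWords i n k, f (w ++ v) := by
  rw [blockWords, Finset.sum_image, Finset.sum_product]
  rintro ⟨v, w⟩ h ⟨v', w'⟩ h' heq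
  simp only [Finset.coe_product, Finset.coe_filter, Set.mem_prod, Set.mem_ofPred_eq,
    mem_words] at h h'
  obtain ⟨h1, h2⟩ := List.append_inj' heq (h.1.1.trans h'.1.1.symm)
  exact Prod.ext h2 h1

theorem blockWords_subset (i : Fin b) (n k : ℕ) :
    blockWords i n k ⊆ (words b (k * n)).filter fun w => colour i w = i := by
  induction k with
  | zero => simp [blockWords, words, colour]
  | succ k ih =>
    intro u hu
    simp only [blockWords, Finset.mem_image, Finset.mem_product, Finset.mem_filter, Prod.exists,
      mem_words] at hu
    obtain ⟨v, w, ⟨⟨h1, h2⟩, h3⟩, rfl⟩ := hu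
    have h4 := Finset.mem_filter.1 (ih h3)
    rw [mem_words] at h4
    rw [Finset.mem_filter, mem_words, colour_append, h2, List.length_append, h4.1, h1]
    exact ⟨by ring, h4.2⟩

section Block

variable (ν : Fin b → Measure (JumpVector b)) [∀ i, IsProbabilityMeasure (ν i)]

theorem lintegral_cond_append (i : Fin b) (v w : Vertex b) (s : ℝ) :
    ∫⁻ e, ENNReal.ofReal (cond e (w ++ v) ^ s) ∂(envLaw ν i) =
      (∫⁻ e, ENNReal.ofReal (cond e v ^ s) ∂(envLaw ν i)) *
        ∫⁻ e, ENNReal.ofReal (cond e w ^ s) ∂(envLaw ν (colour i v)) := by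
  rw [← lintegral_mul_shift ν i v ((measurable_cond v).pow_const s).ennreal_ofReal
    ((measurable_cond w).pow_const s).ennreal_ofReal]
  · refine lintegral_congr fun e => ?_
    rw [cond_append, Real.mul_rpow (cond_pos _ _).le (cond_pos _ _).le,
      ENNReal.ofReal_mul (Real.rpow_nonneg (cond_pos _ _).le _)]
  · intro e e' h
    have hw : cond e v = cond e' v := dependsOn_cond v fun u hu => h u fun hsuf =>
      absurd hsuf.length_le (not_le.2 hu)
    simp only [hw]

/-- Every block ends at colour `i`, so the next one starts afresh under the same law. The moments
become exact powers of a scalar, as the large deviation bound requires. -/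
theorem sum_blockWords_lintegral {s : ℝ} (hs : s ∈ momentDomain ν) (i : Fin b) (n k : ℕ) :
    ∑ w ∈ blockWords i n k, ∫⁻ e, ENNReal.ofReal (cond e w ^ s) ∂(envLaw ν i) =
      ENNReal.ofReal ((momentMatrix ν s ^ n) i i) ^ k := by
  induction k with
  | zero => simp [blockWords, cond]
  | succ k ih =>
    rw [sum_blockWords_succ, pow_succ', ← ih, ← sum_lintegral_cond_eq_pow ν hs n i i,
      ← Finset.sum_filter, Finset.sum_mul]
    refine Finset.sum_congr rfl fun v hv => ?_
    rw [Finset.mul_sum]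
    refine Finset.sum_congr rfl fun w _ => ?_
    rw [lintegral_cond_append, (Finset.mem_filter.1 hv).2]

/-- If `λ₁ > 1`, the expected number of vertices of some generation and of colour `i`, with
conductance at least `Y`, exceeds `1 / Y`, for some `Y ≤ 1`. -/
theorem exists_inv_lt_sum_measure_le_cond (hD : Set.Icc 0 1 ⊆ momentDomain ν)
    (hl : 1 < lambdaOne ν) (i : Fin b) :
    ∃ (L : ℕ) (Y : ℝ), 0 < Y ∧ Y ≤ 1 ∧ ENNReal.ofReal Y⁻¹ <
      ∑ w ∈ (words b L).filter (fun w => colour i w = i), envLaw ν i {e | Y ≤ cond e w} := by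
  have : Nonempty (Fin b) := ⟨i⟩
  obtain ⟨N, hN⟩ := exists_two_le_pow_momentMatrix ν hD hl i
  set φ : ℝ → ℝ := fun s => (momentMatrix ν s ^ N) i i with hφ
  have hIoo : Set.Ioo (0 : ℝ) 1 ⊆ Set.Icc 0 1 := Set.Ioo_subset_Icc_self
  have hlog : ∀ w : Vertex b, Measurable fun e : Vertex b → JumpVector b => Real.log (cond e w) :=
    fun w => (measurable_cond w).log
  obtain ⟨k, z, hz, h⟩ := exists_exp_neg_lt_measure_Ici
    (fun k => ∑ w ∈ blockWords i N k, (envLaw ν i).map fun e => Real.log (cond e w))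
    (f := fun s => Real.log (φ s)) (f' := fun s => deriv φ s / φ s) (ε := Real.log 2)
    (Real.log_pos one_lt_two)
    (fun s hs => (differentiableAt_pow_momentMatrix ν hD hs N i i).hasDerivAt.log
      (by have := hN s (hIoo hs); linarith))
    (fun s hs => Real.log_le_log two_pos (hN s (hIoo hs)))
    (fun k s hs => by
      have hφ0 : 0 < φ s := by have := hN s (hIoo hs); linarith
      rw [lintegral_finsetSum_measure, mul_comm, Real.exp_mul, Real.exp_log hφ0, Real.rpow_natCast,
        ENNReal.ofReal_pow hφ0.le, ← sum_blockWords_lintegral ν (hD (hIoo hs)) i N k]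
      refine Finset.sum_congr rfl fun w _ => ?_
      rw [lintegral_map (by fun_prop) (hlog w)]
      refine lintegral_congr fun e => ?_
      rw [Real.rpow_def_of_pos (cond_pos e w), mul_comm])
  refine ⟨k * N, Real.exp z, Real.exp_pos z, Real.exp_le_one_iff.2 hz, ?_⟩
  rw [← Real.exp_neg]
  refine h.trans_le ?_
  rw [Measure.finsetSum_apply]
  refine le_trans (Finset.sum_le_sum fun w _ => le_of_eq ?_)
    (Finset.sum_le_sum_of_subset (blockWords_subset i N k))
  rw [Measure.map_apply (hlog w) measurableSet_Ici]
  congr 1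
  ext e
  exact Real.le_log_iff_exp_le (cond_pos e w)

end Block

/-- The resistance of the path from the root to `u`. -/
noncomputable def resistance (e : Vertex b → JumpVector b) : Vertex b → ℝ
  | [] => 0
  | j :: w => resistance e w + (cond e (j :: w))⁻¹

theorem measurable_resistance (u : Vertex b) :
    Measurable fun e : Vertex b → JumpVector b => resistance e u := by
  induction u with
  | nil => exact measurable_const
  | cons j w ih => exact ih.add (measurable_cond (j :: w)).inv

theorem dependsOn_resistance (u : Vertex b) :
    DependsOn (fun e : Vertex b → JumpVector b => resistance e u) {w | w.length < u.length} := by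
  induction u with
  | nil => intro e e' _; rfl
  | cons j w ih =>
    intro e e' h
    have h1 : resistance e w = resistance e' w := ih fun v hv => h v (by
      simp only [Set.mem_ofPred_eq, List.length_cons] at hv ⊢; omega)
    have h2 : cond e (j :: w) = cond e' (j :: w) := dependsOn_cond (j :: w) h
    simp only [resistance, h1, h2]

/-- The environments in which the vertex `w` has conductance at least `Y` and can be reached
through a path of resistance at most `R`. -/
def goodSet (Y R : ℝ) (w : Vertex b) : Set (Vertex b → JumpVector b) :=
  {e | Y ≤ cond e w ∧ resistance e w ≤ R}

theorem measurableSet_goodSet (Y R : ℝ) (w : Vertex b) : MeasurableSet (goodSet Y R w) :=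
  (measurableSet_le measurable_const (measurable_cond w)).inter
    (measurableSet_le (measurable_resistance w) measurable_const)

/-- Resistances are finite, so the good sets increase to `{Y ≤ cond}` as `R → ∞`, and a strict
inequality survives for large `R`. -/
theorem exists_inv_lt_sum_measure_goodSet (ν : Fin b → Measure (JumpVector b))
    [∀ i, IsProbabilityMeasure (ν i)] (hD : Set.Icc 0 1 ⊆ momentDomain ν)
    (hl : 1 < lambdaOne ν) (i : Fin b) :
    ∃ (L : ℕ) (Y R : ℝ), 0 < Y ∧ Y ≤ 1 ∧ 0 ≤ R ∧ ENNReal.ofReal Y⁻¹ <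
      ∑ w ∈ (words b L).filter (fun w => colour i w = i), envLaw ν i (goodSet Y R w) := by
  obtain ⟨L, Y, hY, hY1, h⟩ := exists_inv_lt_sum_measure_le_cond ν hD hl i
  have hlim : Filter.Tendsto (fun R : ℕ =>
      ∑ w ∈ (words b L).filter (fun w => colour i w = i), envLaw ν i (goodSet Y R w))
      Filter.atTop (nhds (∑ w ∈ (words b L).filter (fun w => colour i w = i),
        envLaw ν i {e | Y ≤ cond e w})) := by
    refine tendsto_finsetSum _ fun w _ => ?_
    have hU : {e | Y ≤ cond e w} = ⋃ R : ℕ, goodSet Y R w := by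
      ext e
      simp only [Set.mem_ofPred_eq, Set.mem_iUnion, goodSet]
      exact ⟨fun h => (exists_nat_ge (resistance e w)).imp fun R hR => ⟨h, hR⟩,
        fun ⟨R, h, _⟩ => h⟩
    rw [hU]
    refine tendsto_measure_iUnion_atTop fun R R' hR e he => ⟨he.1, he.2.trans ?_⟩
    exact_mod_cast hR
  obtain ⟨R, hR⟩ := (hlim.eventually_const_lt h).exists
  exact ⟨L, Y, R, hY, hY1, Nat.cast_nonneg R, hR⟩

end ColouredTree

namespace ColouredTree

variable {b : ℕ}

theorem sum_words_succ' {M : Type*} [AddCommMonoid M] (n : ℕ) (f : Vertex b → M) :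
    ∑ u ∈ words b (n + 1), f u = ∑ j, ∑ w ∈ words b n, f (w ++ [j]) := by
  rw [sum_words_add n 1, sum_words_succ 0]
  simp [words]

theorem card_words (n : ℕ) : (words b n).card = b ^ n := by
  induction n with
  | zero => simp [words]
  | succ n ih =>
    rw [Finset.card_eq_sum_ones, sum_words_succ]
    simp [ih, pow_succ]

/-- Series law: seen from the root, all conductances beyond the first edge are multiplied by the
ratio of that edge. -/
theorem resistance_append_singleton (e : Vertex b → JumpVector b) (w : Vertex b) (j : Fin b) :
    resistance e (w ++ [j]) = (ratio j (e []))⁻¹ * (1 + resistance (shift [j] e) w) := by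
  have hc : ∀ w : Vertex b, cond e (w ++ [j]) = ratio j (e []) * cond (shift [j] e) w := fun w => by
    rw [cond_append]; simp [cond]
  induction w with
  | nil => simp [resistance, cond]
  | cons k w ih =>
    have := hc (k :: w)
    rw [List.cons_append] at this ⊢
    rw [resistance, ih, this, resistance, mul_inv]
    ring

theorem resistance_nonneg (e : Vertex b → JumpVector b) (w : Vertex b) : 0 ≤ resistance e w := by
  induction w with
  | nil => exact le_rfl
  | cons k w ih => exact add_nonneg ih (inv_nonneg.2 (cond_pos _ _).le)

/-! ### Escape probabilities -/

/-- The probability that the walk started at the root reaches generation `n` before it jumps from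
the root to the parent of the root. -/
noncomputable def escape : ℕ → (Vertex b → JumpVector b) → ℝ
  | 0, _ => 1
  | n + 1, e => (∑ j, ratio j (e []) * escape n (shift [j] e)) /
      (1 + ∑ j, ratio j (e []) * escape n (shift [j] e))

theorem escape_nonneg (n : ℕ) (e : Vertex b → JumpVector b) : 0 ≤ escape n e := by
  induction n generalizing e with
  | zero => exact zero_le_one
  | succ n ih =>
    have : 0 ≤ ∑ j, ratio j (e []) * escape n (shift [j] e) :=
      Finset.sum_nonneg fun j _ => mul_nonneg (ratio_pos _ _).le (ih _)
    exact div_nonneg this (by linarith)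

theorem sum_ratio_escape_nonneg (n : ℕ) (e : Vertex b → JumpVector b) :
    0 ≤ ∑ j, ratio j (e []) * escape n (shift [j] e) :=
  Finset.sum_nonneg fun _ _ => mul_nonneg (ratio_pos _ _).le (escape_nonneg _ _)

theorem escape_le_one (n : ℕ) (e : Vertex b → JumpVector b) : escape n e ≤ 1 := by
  cases n with
  | zero => exact le_rfl
  | succ n =>
    have := sum_ratio_escape_nonneg n e
    rw [escape, div_le_one (by linarith)]
    linarith

theorem div_one_add_le_div_one_add {x y : ℝ} (hx : 0 ≤ x) (hxy : x ≤ y) :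
    x / (1 + x) ≤ y / (1 + y) := by
  rw [div_le_div_iff₀ (by linarith) (by linarith)]
  nlinarith

theorem escape_succ_le (n : ℕ) (e : Vertex b → JumpVector b) : escape (n + 1) e ≤ escape n e := by
  induction n generalizing e with
  | zero => exact escape_le_one 1 e
  | succ n ih =>
    refine div_one_add_le_div_one_add (sum_ratio_escape_nonneg _ e) ?_
    exact Finset.sum_le_sum fun j _ => mul_le_mul_of_nonneg_left (ih _) (ratio_pos _ _).le

theorem antitone_escape (e : Vertex b → JumpVector b) : Antitone fun n => escape n e :=
  antitone_nat_of_succ_le fun n => escape_succ_le n e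

theorem measurable_escape (n : ℕ) : Measurable (escape (b := b) n) := by
  induction n with
  | zero => exact measurable_const
  | succ n ih =>
    have : Measurable fun e : Vertex b → JumpVector b =>
        ∑ j, ratio j (e []) * escape n (shift [j] e) :=
      Finset.measurable_fun_sum _ fun j _ =>
        ((measurable_ratio j).comp (measurable_pi_apply (X := fun _ : Vertex b => JumpVector b) []
          )).mul (ih.comp (measurable_shift _))
    exact this.div (measurable_const.add this)

/-- A dual form of Thomson's principle for a resistor in series with a network. -/
theorem quadratic_le_div_one_add {S θ q : ℝ} (hS : 0 ≤ S) (hq : 0 ≤ q)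
    (h : ∀ c : ℝ, 2 * c * θ - c ^ 2 * q ≤ S) (c : ℝ) :
    2 * c * θ - c ^ 2 * (θ ^ 2 + q) ≤ S / (1 + S) := by
  rw [le_div_iff₀ (by linarith)]
  set m := c * θ with hm
  have hrw : 2 * c * θ - c ^ 2 * (θ ^ 2 + q) = 2 * m - m ^ 2 - c ^ 2 * q := by rw [hm]; ring
  rw [hrw]
  have hcq : 0 ≤ c ^ 2 * q := by positivity
  rcases hS.eq_or_lt with h0 | h0
  · have := h c
    rw [← h0] at this ⊢
    nlinarith [sq_nonneg m]
  rcases eq_or_ne m 0 with hm0 | hm0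
  · rw [hm0]; nlinarith
  -- This multiplier is `S / θ`; it makes the linear term `2 * S` and yields `θ ^ 2 ≤ S * q`. What
  -- remains is a perfect square.
  have hk := h (S / m * c)
  have e1 : 2 * (S / m * c) * θ = 2 * S := by
    rw [show 2 * (S / m * c) * θ = 2 * (S / m * (c * θ)) by ring, ← hm, div_mul_cancel₀ _ hm0]
  rw [e1, mul_pow, div_pow] at hk
  have h2 : m ^ 2 / S ≤ c ^ 2 * q := by
    rw [div_le_iff₀ h0]
    have hm2 : 0 < m ^ 2 := by positivity
    have h3 : S ≤ S ^ 2 * (c ^ 2 * q) / m ^ 2 := by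
      have : S ^ 2 / m ^ 2 * c ^ 2 * q = S ^ 2 * (c ^ 2 * q) / m ^ 2 := by ring
      linarith
    rw [le_div_iff₀ hm2] at h3
    nlinarith
  have h4 : (2 * m - m ^ 2 - m ^ 2 / S) * (1 + S) ≤ S := by
    have : S - (2 * m - m ^ 2 - m ^ 2 / S) * (1 + S) = (m * (1 + S) - S) ^ 2 / S := by
      field_simp; ring
    have h5 : 0 ≤ (m * (1 + S) - S) ^ 2 / S := by positivity
    linarith
  nlinarith

/-- Thomson's principle: the escape probability is bounded below in terms of a flow `θ` through the
`L`-th generation, given such bounds for the subtrees rooted at that generation. -/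
theorem quadratic_le_escape (hb : 1 ≤ b) (n L : ℕ) (e : Vertex b → JumpVector b)
    (θ Q : Vertex b → ℝ) (hQ : ∀ w ∈ words b L, 0 ≤ Q w)
    (h : ∀ w ∈ words b L, ∀ c : ℝ, 2 * c * θ w - c ^ 2 * Q w ≤ escape n (shift w e)) (c : ℝ) :
    2 * c * ∑ w ∈ words b L, θ w -
      c ^ 2 * ∑ w ∈ words b L,
        ((b : ℝ) ^ L * ((1 + resistance e w) * θ w ^ 2) + (cond e w)⁻¹ * Q w) ≤
      escape (n + L) e := by
  induction L generalizing e θ Q c with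
  | zero =>
    have h0 := h [] (by simp [words]) c
    rw [shift_nil] at h0
    simp only [words, Finset.sum_singleton, resistance, cond, pow_zero, add_zero]
    nlinarith [mul_nonneg (sq_nonneg c) (sq_nonneg (θ []))]
  | succ L ih =>
    have hmem : ∀ j : Fin b, ∀ w ∈ words b L, w ++ [j] ∈ words b (L + 1) := fun j w hw => by
      rw [mem_words] at hw ⊢; simp [hw]
    have ihj := fun j => ih (shift [j] e) (fun w => θ (w ++ [j])) (fun w => Q (w ++ [j]))
      (fun w hw => hQ _ (hmem j w hw))
      (fun w hw => by rw [shift_shift]; exact h _ (hmem j w hw))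
    set Θ : Fin b → ℝ := fun j => ∑ w ∈ words b L, θ (w ++ [j]) with hΘ
    set E : Fin b → ℝ := fun j => ∑ w ∈ words b L,
        ((b : ℝ) ^ L * ((1 + resistance (shift [j] e) w) * θ (w ++ [j]) ^ 2) +
          (cond (shift [j] e) w)⁻¹ * Q (w ++ [j])) with hE
    have hE0 : ∀ j, 0 ≤ E j := fun j => Finset.sum_nonneg fun w hw => by
      have h1 := resistance_nonneg (shift [j] e) w
      have h2 := (inv_pos.2 (cond_pos (shift [j] e) w)).le
      have h3 := hQ _ (hmem j w hw)
      positivity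
    have hstep := quadratic_le_div_one_add (θ := ∑ j, Θ j) (q := ∑ j, (ratio j (e []))⁻¹ * E j)
      (sum_ratio_escape_nonneg (n + L) e)
      (Finset.sum_nonneg fun j _ => mul_nonneg (inv_nonneg.2 (ratio_pos _ _).le) (hE0 j))
      -- The bound of each child is taken at `c / ratio` and multiplied by `ratio`, so that its
      -- energy is divided by `ratio`.
      (fun c => by
        rw [Finset.mul_sum, Finset.mul_sum, ← Finset.sum_sub_distrib]
        refine Finset.sum_le_sum fun j _ => ?_
        have hr := ratio_pos j (e [])
        have := mul_le_mul_of_nonneg_left (ihj j (c / ratio j (e []))) hr.le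
        refine le_trans (le_of_eq ?_) this
        simp only [hΘ, hE]
        field_simp) c
    refine le_trans ?_ hstep
    rw [sum_words_succ', sum_words_succ']
    refine sub_le_sub_left (mul_le_mul_of_nonneg_left ?_ (sq_nonneg c)) _
    -- The energy dissipated above the root is the square of the total flow. Cauchy–Schwarz spreads
    -- it over the `b ^ (L + 1)` end vertices, which accounts for the power of `b` and for the `1`
    -- added to the resistance.
    have hCS : (∑ j, Θ j) ^ 2 ≤ ∑ j, ∑ w ∈ words b L, (b : ℝ) ^ (L + 1) * θ (w ++ [j]) ^ 2 := by
      have := sq_sum_le_card_mul_sum_sq (s := words b (L + 1)) (f := θ)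
      rw [card_words, sum_words_succ', sum_words_succ'] at this
      simpa only [Finset.mul_sum, Nat.cast_pow] using this
    calc (∑ j, Θ j) ^ 2 + ∑ j, (ratio j (e []))⁻¹ * E j
        ≤ (∑ j, ∑ w ∈ words b L, (b : ℝ) ^ (L + 1) * θ (w ++ [j]) ^ 2) +
          ∑ j, (ratio j (e []))⁻¹ * E j := by linarith
      _ ≤ _ := by
        rw [← Finset.sum_add_distrib]
        refine Finset.sum_le_sum fun j _ => ?_
        rw [hE, Finset.mul_sum, ← Finset.sum_add_distrib]
        refine Finset.sum_le_sum fun w _ => ?_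
        have hc : cond e (w ++ [j]) = ratio j (e []) * cond (shift [j] e) w := by
          rw [cond_append]; simp [cond]
        rw [resistance_append_singleton, hc, mul_inv]
        have h1 := resistance_nonneg (shift [j] e) w
        have h2 := (inv_pos.2 (ratio_pos j (e []))).le
        have hpow : (b : ℝ) ^ L ≤ (b : ℝ) ^ (L + 1) :=
          pow_le_pow_right₀ (by exact_mod_cast hb) (Nat.le_succ L)
        have h3 : 0 ≤ (ratio j (e []))⁻¹ * ((1 + resistance (shift [j] e) w) * θ (w ++ [j]) ^ 2) := by
          positivity
        nlinarith [mul_le_mul_of_nonneg_right hpow h3]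

end ColouredTree

/-! ### A random flow along good vertices: energy and moments -/

namespace ColouredTree

variable {b : ℕ}

/-- The vertices of generation `L` whose colour is that of the root `i`. -/
def sameColour (i : Fin b) (L : ℕ) : Finset (Vertex b) :=
  (words b L).filter fun w => colour i w = i

/-- The flow into the root that splits, with weights `c`, along the good vertices of the successive
blocks of `L` generations. -/
noncomputable def flow (i : Fin b) (L : ℕ) (Y R : ℝ) (c : ℝ≥0) :
    ℕ → (Vertex b → JumpVector b) → ℝ≥0
  | 0, _ => 1
  | k + 1, e => c * ∑ w ∈ sameColour i L,
      (goodSet Y R w).indicator 1 e * flow i L Y R c k (shift w e)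

/-- An upper bound for the energy of `flow`. -/
noncomputable def energy (i : Fin b) (L : ℕ) (Y R : ℝ) (c A B : ℝ≥0) :
    ℕ → (Vertex b → JumpVector b) → ℝ≥0
  | 0, _ => 1
  | k + 1, e => A * (∑ w ∈ sameColour i L,
        (goodSet Y R w).indicator 1 e * flow i L Y R c k (shift w e) ^ 2) +
      B * ∑ w ∈ sameColour i L,
        (goodSet Y R w).indicator 1 e * energy i L Y R c A B k (shift w e)

theorem measurable_flow (i : Fin b) (L : ℕ) (Y R : ℝ) (c : ℝ≥0) (k : ℕ) :
    Measurable (flow i L Y R c k) := by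
  induction k with
  | zero => exact measurable_const
  | succ k ih =>
    exact (Finset.measurable_fun_sum _ fun w _ =>
      (measurable_one.indicator (measurableSet_goodSet Y R w)).mul
        (ih.comp (measurable_shift w))).const_mul c

theorem measurable_energy (i : Fin b) (L : ℕ) (Y R : ℝ) (c A B : ℝ≥0) (k : ℕ) :
    Measurable (energy i L Y R c A B k) := by
  induction k with
  | zero => exact measurable_const
  | succ k ih =>
    exact ((Finset.measurable_fun_sum _ fun w _ =>
      (measurable_one.indicator (measurableSet_goodSet Y R w)).mul
        (((measurable_flow i L Y R c k).comp (measurable_shift w)).pow_const 2)).const_mul A).add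
      ((Finset.measurable_fun_sum _ fun w _ =>
      (measurable_one.indicator (measurableSet_goodSet Y R w)).mul
        (ih.comp (measurable_shift w))).const_mul B)

/-- The escape probability is bounded below in terms of the flow and its energy. -/
theorem flow_sub_energy_le_escape (i : Fin b) (L : ℕ) {Y R : ℝ} (hY : 0 < Y) {c A B : ℝ≥0}
    (hA : (b : ℝ) ^ L * (1 + R) * c ^ 2 ≤ A) (hB : Y⁻¹ * c ^ 2 ≤ B) (k : ℕ)
    (e : Vertex b → JumpVector b) (x : ℝ) :
    2 * x * flow i L Y R c k e - x ^ 2 * energy i L Y R c A B k e ≤ escape (k * L) e := by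
  classical
  have hb : 1 ≤ b := (Nat.zero_le _).trans_lt i.isLt
  induction k generalizing e x with
  | zero =>
    simp only [flow, energy, Nat.zero_mul, escape, NNReal.coe_one]
    nlinarith [sq_nonneg (x - 1)]
  | succ k ih =>
    -- An idempotent indicator extends the sums to the whole generation, where Thomson's bound
    -- applies.
    set χ : Vertex b → ℝ := fun w =>
      if colour i w = i ∧ e ∈ goodSet Y R w then 1 else 0 with hχ
    have hχ2 : ∀ w, χ w ^ 2 = χ w := fun w => by simp only [hχ]; split_ifs <;> norm_num
    have hχ0 : ∀ w, 0 ≤ χ w := fun w => by simp only [hχ]; split_ifs <;> norm_num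
    have hsum : ∀ g : Vertex b → ℝ≥0, ((∑ w ∈ sameColour i L,
        (goodSet Y R w).indicator 1 e * g w : ℝ≥0) : ℝ) = ∑ w ∈ words b L, χ w * g w := fun g => by
      rw [sameColour, Finset.sum_filter, NNReal.coe_sum]
      refine Finset.sum_congr rfl fun w _ => ?_
      by_cases h1 : colour i w = i <;> by_cases h2 : e ∈ goodSet Y R w <;> simp [hχ, h1, h2]
    have key := quadratic_le_escape hb (k * L) L e
      (fun w => c * (χ w * flow i L Y R c k (shift w e)))
      (fun w => c ^ 2 * (χ w * energy i L Y R c A B k (shift w e)))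
      (fun w _ => by have := hχ0 w; positivity)
      (fun w _ y => by
        have h1 := ih (shift w e) (y * c)
        have h2 := escape_nonneg (k * L) (shift w e)
        by_cases h : colour i w = i ∧ e ∈ goodSet Y R w
        · simp only [hχ, if_pos h]
          nlinarith
        · simp only [hχ, if_neg h]
          simpa using h2) x
    rw [show (k + 1) * L = k * L + L by ring]
    refine le_trans ?_ key
    rw [← Finset.mul_sum, flow, energy]
    simp only [NNReal.coe_add, NNReal.coe_mul]
    rw [hsum fun w => flow i L Y R c k (shift w e)]
    refine sub_le_sub_left (mul_le_mul_of_nonneg_left ?_ (sq_nonneg x)) _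
    have e1 := hsum fun w => flow i L Y R c k (shift w e) ^ 2
    have e2 := hsum fun w => energy i L Y R c A B k (shift w e)
    simp only [NNReal.coe_pow] at e1
    rw [e1, e2, Finset.mul_sum, Finset.mul_sum, ← Finset.sum_add_distrib]
    refine Finset.sum_le_sum fun w _ => ?_
    rw [mul_pow, mul_pow, hχ2]
    by_cases h : colour i w = i ∧ e ∈ goodSet Y R w
    · simp only [hχ, if_pos h, one_mul]
      -- The two defining bounds of a good vertex produce the constants: `R` enters `A`, and `Y⁻¹`
      -- enters `B`.
      have hres : 1 + resistance e w ≤ 1 + R := by linarith [h.2.2]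
      have hcond : (cond e w)⁻¹ ≤ Y⁻¹ := inv_anti₀ hY h.2.1
      have hE : (0 : ℝ) ≤ energy i L Y R c A B k (shift w e) := NNReal.coe_nonneg _
      refine add_le_add ?_ ?_
      · calc (b : ℝ) ^ L * ((1 + resistance e w) * (c ^ 2 * flow i L Y R c k (shift w e) ^ 2))
            = ((b : ℝ) ^ L * (1 + resistance e w) * c ^ 2) * flow i L Y R c k (shift w e) ^ 2 := by
              ring
          _ ≤ ((b : ℝ) ^ L * (1 + R) * c ^ 2) * flow i L Y R c k (shift w e) ^ 2 := by gcongr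
          _ ≤ A * flow i L Y R c k (shift w e) ^ 2 := by gcongr
      · calc (cond e w)⁻¹ * (c ^ 2 * energy i L Y R c A B k (shift w e))
            ≤ Y⁻¹ * (c ^ 2 * energy i L Y R c A B k (shift w e)) := by gcongr
          _ = Y⁻¹ * c ^ 2 * energy i L Y R c A B k (shift w e) := by ring
          _ ≤ _ := by gcongr
    · simp [hχ, if_neg h]

theorem exists_bound_of_le_mul_add {x : ℕ → ℝ≥0∞} {α β : ℝ≥0} (hα : α < 1) (h0 : x 0 ≤ 1)
    (h : ∀ k, x (k + 1) ≤ α * x k + β) : ∃ C : ℝ≥0, 1 ≤ C ∧ ∀ k, x k ≤ C := by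
  have hα' : (0 : ℝ) < 1 - α := sub_pos.2 (by exact_mod_cast hα)
  -- With this choice `α * C + β = C - 1`.
  set C : ℝ≥0 := (1 + β) / (1 - α) with hC
  have hsub : ((1 - α : ℝ≥0) : ℝ) = 1 - α := NNReal.coe_sub hα.le
  have hCr : (C : ℝ) * (1 - α) = 1 + β := by
    rw [hC, NNReal.coe_div, hsub, div_mul_cancel₀ _ hα'.ne']; simp
  have h1 : 1 ≤ C := by
    have hβ := β.coe_nonneg
    have : (1 : ℝ) ≤ C := by
      nlinarith [C.coe_nonneg, α.coe_nonneg, mul_nonneg C.coe_nonneg α.coe_nonneg]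
    exact_mod_cast this
  have hrec : α * C + β ≤ C := by
    have : (α * C + β : ℝ) ≤ C := by nlinarith
    exact_mod_cast this
  refine ⟨C, h1, fun k => ?_⟩
  induction k with
  | zero => exact h0.trans (by exact_mod_cast h1)
  | succ k ih =>
    calc x (k + 1) ≤ α * x k + β := h k
      _ ≤ α * C + β := by gcongr
      _ ≤ C := by exact_mod_cast hrec

section Moments

variable (ν : Fin b → Measure (JumpVector b)) [∀ i, IsProbabilityMeasure (ν i)]

theorem dependsOn_indicator_goodSet (Y R : ℝ) {w : Vertex b} {L : ℕ} (hw : w ∈ words b L)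
    {v : Vertex b} (hv : v ∈ words b L) :
    DependsOn (fun e : Vertex b → JumpVector b => ((goodSet Y R w).indicator 1 e : ℝ≥0∞))
      {u | ¬ v <:+ u} := by
  intro e e' h
  rw [mem_words] at hw hv
  have hsub : ∀ u ∈ {u : Vertex b | u.length < w.length}, e u = e' u := fun u hu =>
    h u fun hs => absurd hs.length_le (by
      simp only [Set.mem_ofPred_eq] at hu; omega)
  have h1 : cond e w = cond e' w := dependsOn_cond w hsub
  have h2 : resistance e w = resistance e' w := dependsOn_resistance w hsub
  have : e ∈ goodSet Y R w ↔ e' ∈ goodSet Y R w := by simp only [goodSet, Set.mem_ofPred_eq, h1, h2]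
  by_cases he : e ∈ goodSet Y R w
  · simp [he, this.1 he]
  · have he' := mt this.2 he
    simp [he, he']

theorem lintegral_goodSet_mul_shift (i : Fin b) {L : ℕ} (Y R : ℝ) {w : Vertex b}
    (hw : w ∈ sameColour i L) {g : (Vertex b → JumpVector b) → ℝ≥0∞} (hg : Measurable g) :
    ∫⁻ e, (goodSet Y R w).indicator 1 e * g (shift w e) ∂(envLaw ν i) =
      envLaw ν i (goodSet Y R w) * ∫⁻ e, g e ∂(envLaw ν i) := by
  have h := Finset.mem_filter.1 hw
  rw [lintegral_mul_shift ν i w (measurable_one.indicator (measurableSet_goodSet Y R w)) hg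
    (dependsOn_indicator_goodSet Y R h.1 h.1), h.2,
    lintegral_indicator_one (measurableSet_goodSet Y R w)]

theorem lintegral_sum_goodSet_mul_shift (i : Fin b) (L : ℕ) (Y R : ℝ)
    {g : (Vertex b → JumpVector b) → ℝ≥0∞} (hg : Measurable g) :
    ∫⁻ e, ∑ w ∈ sameColour i L, (goodSet Y R w).indicator 1 e * g (shift w e) ∂(envLaw ν i) =
      (∑ w ∈ sameColour i L, envLaw ν i (goodSet Y R w)) * ∫⁻ e, g e ∂(envLaw ν i) := by
  rw [lintegral_finsetSum, Finset.sum_mul]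
  · exact Finset.sum_congr rfl fun w hw => lintegral_goodSet_mul_shift ν i Y R hw hg
  · exact fun w _ => (measurable_one.indicator (measurableSet_goodSet Y R w)).mul
      (hg.comp (measurable_shift w))

theorem coe_indicator_one (s : Set (Vertex b → JumpVector b)) (e : Vertex b → JumpVector b) :
    ((s.indicator 1 e : ℝ≥0) : ℝ≥0∞) = s.indicator 1 e := by
  by_cases h : e ∈ s <;> simp [h]

/-- The factor `c` is the inverse of the mean number of good vertices, the normalisation of the
branching process martingale. -/
theorem lintegral_flow {i : Fin b} {L : ℕ} {Y R : ℝ} {c : ℝ≥0}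
    (hc : c * ∑ w ∈ sameColour i L, envLaw ν i (goodSet Y R w) = 1) (k : ℕ) :
    ∫⁻ e, flow i L Y R c k e ∂(envLaw ν i) = 1 := by
  induction k with
  | zero => simp [flow]
  | succ k ih =>
    have hm : Measurable fun e => (flow i L Y R c k e : ℝ≥0∞) :=
      (measurable_flow i L Y R c k).coe_nnreal_ennreal
    simp only [flow, ENNReal.coe_mul, ENNReal.ofNNReal_finsetSum, coe_indicator_one]
    rw [lintegral_const_mul, lintegral_sum_goodSet_mul_shift ν i L Y R hm, ih, mul_one, hc]
    exact Finset.measurable_fun_sum _ fun w _ =>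
      (measurable_one.indicator (measurableSet_goodSet Y R w)).mul (hm.comp (measurable_shift w))

/-- The subtrees rooted at two vertices of the same generation are independent. -/
theorem lintegral_shift_mul_shift (i : Fin b) {v w : Vertex b} (hlen : v.length = w.length)
    (hne : v ≠ w) {f g : (Vertex b → JumpVector b) → ℝ≥0∞} (hf : Measurable f)
    (hg : Measurable g) :
    ∫⁻ e, f (shift v e) * g (shift w e) ∂(envLaw ν i) =
      (∫⁻ e, f e ∂(envLaw ν (colour i v))) * ∫⁻ e, g e ∂(envLaw ν (colour i w)) := by
  rw [lintegral_mul_shift ν i w (f := fun e => f (shift v e)) (hf.comp (measurable_shift v)) hg,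
    lintegral_shift ν i v hf]
  intro e e' h
  have : shift v e = shift v e' := funext fun u => h _ fun hs => hne
    ((List.suffix_of_suffix_length_le (List.suffix_append u v) hs hlen.le).eq_of_length hlen)
  simp only [this]

/-- Diagonal terms carry `c ^ 2` times the mean number `1 / c` of good vertices. Off-diagonal ones
involve independent subtrees, each with flow of mean `1`. The recursion contracts when `c < 1`. -/
theorem lintegral_flow_sq_succ_le {i : Fin b} {L : ℕ} {Y R : ℝ} {c : ℝ≥0}
    (hc : c * ∑ w ∈ sameColour i L, envLaw ν i (goodSet Y R w) = 1) (k : ℕ) :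
    ∫⁻ e, (flow i L Y R c (k + 1) e : ℝ≥0∞) ^ 2 ∂(envLaw ν i) ≤
      c * (∫⁻ e, (flow i L Y R c k e : ℝ≥0∞) ^ 2 ∂(envLaw ν i)) +
        (c ^ 2 * (sameColour i L).card ^ 2 : ℝ≥0) := by
  have hm : Measurable fun e => (flow i L Y R c k e : ℝ≥0∞) :=
    (measurable_flow i L Y R c k).coe_nnreal_ennreal
  have hχ : ∀ (w : Vertex b) (e : Vertex b → JumpVector b),
      ((goodSet Y R w).indicator 1 e : ℝ≥0∞) ≤ 1 := fun w e => by
    by_cases h : e ∈ goodSet Y R w <;> simp [h]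
  have hpt : ∀ e, (flow i L Y R c (k + 1) e : ℝ≥0∞) ^ 2 ≤
      c ^ 2 * ((∑ w ∈ sameColour i L,
          (goodSet Y R w).indicator 1 e * (flow i L Y R c k (shift w e) : ℝ≥0∞) ^ 2) +
        ∑ v ∈ sameColour i L, ∑ w ∈ (sameColour i L).erase v,
          (flow i L Y R c k (shift v e) : ℝ≥0∞) * flow i L Y R c k (shift w e)) := fun e => by
    simp only [flow, ENNReal.coe_mul, ENNReal.ofNNReal_finsetSum, coe_indicator_one]
    rw [mul_pow, sq (∑ w ∈ sameColour i L, _), Finset.sum_mul_sum, ← Finset.sum_add_distrib]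
    refine mul_le_mul_right (Finset.sum_le_sum fun v hv => ?_) _
    rw [← Finset.add_sum_erase _ _ hv]
    refine add_le_add ?_ (Finset.sum_le_sum fun w _ => ?_)
    · rw [mul_mul_mul_comm, ← sq (flow i L Y R c k (shift v e) : ℝ≥0∞)]
      exact mul_le_mul_left (mul_le_of_le_one_right' (hχ v e)) _
    · exact mul_le_mul' (mul_le_of_le_one_left' (hχ v e)) (mul_le_of_le_one_left' (hχ w e))
  have hm1 : Measurable fun e => ∑ w ∈ sameColour i L,
      (goodSet Y R w).indicator 1 e * (flow i L Y R c k (shift w e) : ℝ≥0∞) ^ 2 :=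
    Finset.measurable_fun_sum _ fun w _ =>
      (measurable_one.indicator (measurableSet_goodSet Y R w)).mul
        ((hm.comp (measurable_shift w)).pow_const 2)
  have hm2 : ∀ v w : Vertex b, Measurable fun e =>
      (flow i L Y R c k (shift v e) : ℝ≥0∞) * flow i L Y R c k (shift w e) := fun v w =>
    (hm.comp (measurable_shift v)).mul (hm.comp (measurable_shift w))
  have hm3 : Measurable fun e => ∑ v ∈ sameColour i L, ∑ w ∈ (sameColour i L).erase v,
      (flow i L Y R c k (shift v e) : ℝ≥0∞) * flow i L Y R c k (shift w e) :=
    Finset.measurable_fun_sum _ fun v _ => Finset.measurable_fun_sum _ fun w _ => hm2 v w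
  refine (lintegral_mono hpt).trans ?_
  rw [lintegral_const_mul _ (by exact hm1.add hm3), lintegral_add_left hm1,
    lintegral_sum_goodSet_mul_shift ν i L Y R (hm.pow_const 2), mul_add, sq (c : ℝ≥0∞), mul_assoc,
    ← mul_assoc (c : ℝ≥0∞) (∑ w ∈ sameColour i L, _), hc, one_mul]
  gcongr
  have hcross : ∫⁻ e, ∑ v ∈ sameColour i L, ∑ w ∈ (sameColour i L).erase v,
      (flow i L Y R c k (shift v e) : ℝ≥0∞) * flow i L Y R c k (shift w e) ∂(envLaw ν i) ≤
      (sameColour i L).card ^ 2 := by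
    rw [lintegral_finsetSum _ fun v _ => Finset.measurable_fun_sum _ fun w _ => hm2 v w]
    calc _ ≤ ∑ v ∈ sameColour i L, ∑ w ∈ sameColour i L, (1 : ℝ≥0∞) := by
          refine Finset.sum_le_sum fun v hv => ?_
          rw [lintegral_finsetSum _ fun w _ => hm2 v w]
          refine le_trans (Finset.sum_le_sum fun w hw => ?_)
            (Finset.sum_le_sum_of_subset (Finset.erase_subset v _))
          have hv' := Finset.mem_filter.1 hv
          have hw' := Finset.mem_filter.1 (Finset.mem_of_mem_erase hw)
          rw [lintegral_shift_mul_shift ν i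
            ((mem_words.1 hv'.1).trans (mem_words.1 hw'.1).symm) (Finset.ne_of_mem_erase hw).symm
            hm hm, hv'.2, hw'.2, lintegral_flow ν hc k, one_mul]
      _ = _ := by simp [sq]
  calc _ ≤ (c : ℝ≥0∞) * c * (sameColour i L).card ^ 2 := by gcongr
    _ = _ := by push_cast; ring

/-- The mean energy obeys an affine recursion of ratio `B * r`, whose inhomogeneous term is
controlled by the second moment of the flow. -/
theorem exists_lintegral_energy_le {i : Fin b} {L : ℕ} {Y R : ℝ} {c A B r : ℝ≥0}
    (hr : ∑ w ∈ sameColour i L, envLaw ν i (goodSet Y R w) = r) (hc : c * r = 1)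
    (hc1 : c < 1) (hB : B * r < 1) :
    ∃ C : ℝ≥0, 1 ≤ C ∧ ∀ k, ∫⁻ e, energy i L Y R c A B k e ∂(envLaw ν i) ≤ C := by
  have hc' : c * ∑ w ∈ sameColour i L, envLaw ν i (goodSet Y R w) = 1 := by
    rw [hr]; exact_mod_cast hc
  obtain ⟨V, -, hV⟩ := exists_bound_of_le_mul_add
    (x := fun k => ∫⁻ e, (flow i L Y R c k e : ℝ≥0∞) ^ 2 ∂(envLaw ν i)) hc1 (by simp [flow])
    (lintegral_flow_sq_succ_le ν hc')
  refine exists_bound_of_le_mul_add (α := B * r) (β := A * (r * V)) hB (by simp [energy])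
    fun k => ?_
  have hm : Measurable fun e => (flow i L Y R c k e : ℝ≥0∞) ^ 2 :=
    (measurable_flow i L Y R c k).coe_nnreal_ennreal.pow_const 2
  have hm' : Measurable fun e => (energy i L Y R c A B k e : ℝ≥0∞) :=
    (measurable_energy i L Y R c A B k).coe_nnreal_ennreal
  have hms : ∀ g : (Vertex b → JumpVector b) → ℝ≥0∞, Measurable g → Measurable fun e =>
      ∑ w ∈ sameColour i L, (goodSet Y R w).indicator 1 e * g (shift w e) := fun g hg =>
    Finset.measurable_fun_sum _ fun w _ =>
      (measurable_one.indicator (measurableSet_goodSet Y R w)).mul (hg.comp (measurable_shift w))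
  simp only [energy, ENNReal.coe_add, ENNReal.coe_mul, ENNReal.ofNNReal_finsetSum, ENNReal.coe_pow,
    coe_indicator_one]
  rw [lintegral_add_left ((hms _ hm).const_mul _), lintegral_const_mul _ (hms _ hm),
    lintegral_const_mul _ (hms _ hm'), lintegral_sum_goodSet_mul_shift ν i L Y R hm,
    lintegral_sum_goodSet_mul_shift ν i L Y R hm', hr, add_comm, mul_assoc]
  gcongr
  exact hV k

end Moments

end ColouredTree

/-! ### Escape to infinity and transience -/

namespace ColouredTree

variable {b : ℕ}

/-- The probability that the walk started at the root never jumps from the root to the parent of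
the root. -/
noncomputable def escapeInf (e : Vertex b → JumpVector b) : ℝ := ⨅ n, escape n e

theorem tendsto_escape (e : Vertex b → JumpVector b) :
    Filter.Tendsto (fun n => escape n e) Filter.atTop (nhds (escapeInf e)) :=
  tendsto_atTop_ciInf (antitone_escape e) ⟨0, by rintro _ ⟨n, rfl⟩; exact escape_nonneg n e⟩

theorem escapeInf_nonneg (e : Vertex b → JumpVector b) : 0 ≤ escapeInf e :=
  ge_of_tendsto' (tendsto_escape e) fun n => escape_nonneg n e

theorem escapeInf_le_one (e : Vertex b → JumpVector b) : escapeInf e ≤ 1 :=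
  le_of_tendsto' (tendsto_escape e) fun n => escape_le_one n e

theorem measurable_escapeInf : Measurable (escapeInf (b := b)) :=
  measurable_of_tendsto_metrizable (fun n => measurable_escape n)
    (tendsto_pi_nhds.2 tendsto_escape)

theorem sum_ratio_escapeInf_nonneg (e : Vertex b → JumpVector b) :
    0 ≤ ∑ j, ratio j (e []) * escapeInf (shift [j] e) :=
  Finset.sum_nonneg fun _ _ => mul_nonneg (ratio_pos _ _).le (escapeInf_nonneg _)

theorem escapeInf_eq (e : Vertex b → JumpVector b) :
    escapeInf e = (∑ j, ratio j (e []) * escapeInf (shift [j] e)) /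
      (1 + ∑ j, ratio j (e []) * escapeInf (shift [j] e)) := by
  have h1 : Filter.Tendsto (fun n => ∑ j, ratio j (e []) * escape n (shift [j] e)) Filter.atTop
      (nhds (∑ j, ratio j (e []) * escapeInf (shift [j] e))) :=
    tendsto_finsetSum _ fun j _ => (tendsto_escape _).const_mul _
  have h2 := h1.div (h1.const_add 1) (by have := sum_ratio_escapeInf_nonneg e; linarith)
  exact tendsto_nhds_unique ((tendsto_escape e).comp (Filter.tendsto_add_atTop_nat 1)) h2

theorem escapeInf_shift_eq_zero {e : Vertex b → JumpVector b} (h : escapeInf e = 0) (j : Fin b) :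
    escapeInf (shift [j] e) = 0 := by
  have h0 := sum_ratio_escapeInf_nonneg e
  rw [escapeInf_eq, div_eq_zero_iff, or_iff_left (by linarith),
    Finset.sum_eq_zero_iff_of_nonneg fun _ _ => mul_nonneg (ratio_pos _ _).le (escapeInf_nonneg _)]
    at h
  exact (mul_eq_zero.1 (h j (Finset.mem_univ j))).resolve_left (ratio_pos _ _).ne'

section Law

variable (ν : Fin b → Measure (JumpVector b)) [∀ i, IsProbabilityMeasure (ν i)]

/-- If `λ₁ > 1`, the walk escapes with positive probability. -/
theorem measure_escapeInf_eq_zero_lt_one (hD : Set.Icc 0 1 ⊆ momentDomain ν)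
    (hl : 1 < lambdaOne ν) (i : Fin b) : envLaw ν i {e | escapeInf e = 0} < 1 := by
  obtain ⟨L, Y, R, hY, hY1, hR, h⟩ := exists_inv_lt_sum_measure_goodSet ν hD hl i
  change _ < ∑ w ∈ sameColour i L, envLaw ν i (goodSet Y R w) at h
  -- Generation `0` has a single vertex, while the mean exceeds `1 / Y ≥ 1`. A positive `L` makes `k
  -- * L` tend to infinity.
  have hL : L ≠ 0 := by
    rintro rfl
    refine absurd h (not_lt.2 ?_)
    calc ∑ w ∈ sameColour i 0, envLaw ν i (goodSet Y R w)
        ≤ ∑ w ∈ words b 0, envLaw ν i (goodSet Y R w) :=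
          Finset.sum_le_sum_of_subset (Finset.filter_subset _ _)
      _ ≤ 1 := by simp only [words, Finset.sum_singleton]; exact prob_le_one
      _ ≤ ENNReal.ofReal Y⁻¹ := by
          rw [ENNReal.one_le_ofReal]; exact (one_le_inv₀ hY).2 hY1
  have hfin : ∑ w ∈ sameColour i L, envLaw ν i (goodSet Y R w) ≠ ∞ :=
    ENNReal.sum_ne_top.2 fun w _ => measure_ne_top _ _
  obtain ⟨r, hr⟩ : ∃ r : ℝ≥0, (r : ℝ≥0∞) = ∑ w ∈ sameColour i L, envLaw ν i (goodSet Y R w) :=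
    ⟨_, ENNReal.coe_toNNReal hfin⟩
  rw [← hr] at h
  have hYr : Y⁻¹ < r := by
    rw [← ENNReal.ofReal_coe_nnreal] at h
    exact (ENNReal.ofReal_lt_ofReal_iff_of_nonneg (inv_pos.2 hY).le).1 h
  have hr1 : 1 < r := by
    have : (1 : ℝ) < r := lt_of_le_of_lt ((one_le_inv₀ hY).2 hY1) hYr
    exact_mod_cast this
  have hr0 : r ≠ 0 := (zero_lt_one.trans hr1).ne'
  set c : ℝ≥0 := r⁻¹ with hc
  have hcr : c * r = 1 := inv_mul_cancel₀ hr0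
  obtain ⟨C, hC1, hC⟩ := exists_lintegral_energy_le ν
    (A := ⟨(b : ℝ) ^ L * (1 + R) * c ^ 2, by positivity⟩) (B := ⟨Y⁻¹ * c ^ 2, by positivity⟩)
    -- Here `B * r = Y⁻¹ / r`, so the energy recursion contracts exactly because `r > 1 / Y`.
    hr.symm hcr (inv_lt_one_of_one_lt₀ hr1) (by
      rw [← NNReal.coe_lt_coe]
      have hcr' : (c : ℝ) * r = 1 := by exact_mod_cast hcr
      have hrpos : (0 : ℝ) < r := (inv_pos.2 hY).trans hYr
      calc Y⁻¹ * (c : ℝ) ^ 2 * r = Y⁻¹ * c * (c * r) := by ring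
        _ = Y⁻¹ * c := by rw [hcr', mul_one]
        _ < r * c := by
          refine mul_lt_mul_of_pos_right hYr ?_
          rw [hc]; positivity
        _ = ((1 : ℝ≥0) : ℝ) := by rw [mul_comm, hcr', NNReal.coe_one])
  set A : ℝ≥0 := ⟨(b : ℝ) ^ L * (1 + R) * c ^ 2, by positivity⟩ with hA
  set B : ℝ≥0 := ⟨Y⁻¹ * c ^ 2, by positivity⟩ with hB
  have hC0 : C ≠ 0 := (zero_lt_one.trans_le hC1).ne'
  have hlow : ∀ k, ((C⁻¹ : ℝ≥0) : ℝ≥0∞) ≤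
      ∫⁻ e, ENNReal.ofReal (escape (k * L) e) ∂(envLaw ν i) := fun k => by
    have hpt : ∀ e, ((2 * C⁻¹ : ℝ≥0) : ℝ≥0∞) * flow i L Y R c k e ≤
        ENNReal.ofReal (escape (k * L) e) +
          ((C⁻¹ ^ 2 : ℝ≥0) : ℝ≥0∞) * energy i L Y R c A B k e := fun e => by
      -- The multiplier `1 / C` is optimal for flow of mean `1` and energy of mean at most `C`: it
      -- leaves `2 / C - 1 / C = 1 / C`.
      have h1 := flow_sub_energy_le_escape i L (R := R) hY (c := c) (A := A) (B := B) le_rfl le_rfl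
        k e (C⁻¹ : ℝ≥0)
      rw [ENNReal.ofReal, ← ENNReal.coe_mul, ← ENNReal.coe_mul, ← ENNReal.coe_add,
        ENNReal.coe_le_coe, ← NNReal.coe_le_coe]
      push_cast [Real.coe_toNNReal _ (escape_nonneg _ _)] at h1 ⊢
      linarith
    have hm : Measurable fun e => (flow i L Y R c k e : ℝ≥0∞) :=
      (measurable_flow i L Y R c k).coe_nnreal_ennreal
    have hm' : Measurable fun e => (energy i L Y R c A B k e : ℝ≥0∞) :=
      (measurable_energy i L Y R c A B k).coe_nnreal_ennreal
    have h2 := lintegral_mono (μ := envLaw ν i) hpt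
    rw [lintegral_const_mul _ hm, lintegral_add_left (measurable_escape _).ennreal_ofReal,
      lintegral_const_mul _ hm', lintegral_flow ν (by rw [← hr]; exact_mod_cast hcr), mul_one] at h2
    have h3 := h2.trans (add_le_add_right (mul_le_mul_right (hC k) _) _)
    rw [← ENNReal.coe_mul, sq, mul_assoc, inv_mul_cancel₀ hC0, mul_one, two_mul,
      ENNReal.coe_add] at h3
    exact (ENNReal.add_le_add_iff_right ENNReal.coe_ne_top).1 h3
  have hlim : Filter.Tendsto (fun n => ∫⁻ e, ENNReal.ofReal (escape n e) ∂(envLaw ν i))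
      Filter.atTop (nhds (∫⁻ e, ENNReal.ofReal (escapeInf e) ∂(envLaw ν i))) := by
    refine tendsto_lintegral_of_dominated_convergence (fun _ => 1)
      (fun n => (measurable_escape n).ennreal_ofReal)
      (fun n => Filter.Eventually.of_forall fun e => ?_) (by simp)
      (Filter.Eventually.of_forall fun e =>
        (ENNReal.continuous_ofReal.tendsto _).comp (tendsto_escape e))
    exact ENNReal.ofReal_le_one.2 (escape_le_one n e)
  have hsub : Filter.Tendsto (fun k : ℕ => k * L) Filter.atTop Filter.atTop :=
    Filter.tendsto_id.atTop_mul_const' (Nat.pos_of_ne_zero hL)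
  have hpos := ge_of_tendsto' (hlim.comp hsub) hlow
  refine lt_of_le_of_ne prob_le_one fun h1 => ?_
  have hae : ∀ᵐ e ∂(envLaw ν i), escapeInf e = 0 :=
    (prob_compl_eq_zero_iff (measurable_escapeInf (measurableSet_singleton 0))).2 h1
  rw [lintegral_congr_ae (g := fun _ => 0) (by filter_upwards [hae] with e he; simp [he]),
    lintegral_zero] at hpos
  simp [hC0] at hpos

/-- A zero-one law: if escape is impossible from the root, it is impossible from the child of colour
`i` and from one of another colour `j`. These subtrees are independent, so `P i ≤ P i * P j` with `P
j < 1`, which forces `P i = 0`. -/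
theorem measure_escapeInf_eq_zero (hb : 2 ≤ b) (hD : Set.Icc 0 1 ⊆ momentDomain ν)
    (hl : 1 < lambdaOne ν) (i : Fin b) : envLaw ν i {e | escapeInf e = 0} = 0 := by
  set Z : Set (Vertex b → JumpVector b) := {e | escapeInf e = 0} with hZ
  have hZm : MeasurableSet Z := measurable_escapeInf (measurableSet_singleton 0)
  have hm : Measurable (Z.indicator (1 : (Vertex b → JumpVector b) → ℝ≥0∞)) :=
    measurable_one.indicator hZm
  have : Nontrivial (Fin b) := Fin.nontrivial_iff_two_le.2 hb
  obtain ⟨j, hj⟩ := exists_ne i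
  have hle : envLaw ν i Z ≤ envLaw ν i Z * envLaw ν j Z := by
    have h := lintegral_shift_mul_shift ν i (v := [i]) (w := [j]) rfl (by simpa using hj.symm) hm hm
    simp only [colour_cons, lintegral_indicator_one hZm] at h
    rw [← h, ← lintegral_indicator_one hZm]
    refine lintegral_mono fun e => ?_
    by_cases he : e ∈ Z
    · have h1 : shift [i] e ∈ Z := escapeInf_shift_eq_zero he i
      have h2 : shift [j] e ∈ Z := escapeInf_shift_eq_zero he j
      simp [h1, h2, he]
    · simp [he]
  by_contra h0
  have hlt := ENNReal.mul_lt_mul_right h0 (measure_ne_top (envLaw ν i) Z)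
    (measure_escapeInf_eq_zero_lt_one ν hD hl j)
  rw [mul_one] at hlt
  exact absurd hle (not_le.2 hlt)

theorem ae_forall_escapeInf_pos (hb : 2 ≤ b) (hD : Set.Icc 0 1 ⊆ momentDomain ν)
    (hl : 1 < lambdaOne ν) (i : Fin b) :
    ∀ᵐ e ∂(envLaw ν i), ∀ u, 0 < escapeInf (shift u e) := by
  rw [ae_all_iff]
  intro u
  have h : ∀ᵐ e ∂(envLaw ν (colour i u)), 0 < escapeInf e := by
    have h0 := measure_escapeInf_eq_zero ν hb hD hl (colour i u)
    filter_upwards [measure_eq_zero_iff_ae_notMem.1 h0] with e he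
    exact lt_of_le_of_ne (escapeInf_nonneg e) fun h => he h.symm
  rw [← map_shift_envLaw] at h
  exact ae_of_ae_map (measurable_shift u).aemeasurable h

end Law

/-- The probability that the walk started at `y` ever visits `x`, when `y` is a descendant of
`x`. -/
noncomputable def hitting (e : Vertex b → JumpVector b) (x : Vertex b) : Vertex b → ℝ
  | [] => 1
  | j :: v => open Classical in
    if x <:+ v then hitting e x v * (1 - escapeInf (shift (j :: v) e)) else 1

theorem hitting_nonneg (e : Vertex b → JumpVector b) (x y : Vertex b) : 0 ≤ hitting e x y := by
  induction y with
  | nil => exact zero_le_one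
  | cons j v ih =>
    rw [hitting]
    split_ifs
    · exact mul_nonneg ih (sub_nonneg.2 (escapeInf_le_one _))
    · exact zero_le_one

theorem hitting_le_one (e : Vertex b → JumpVector b) (x y : Vertex b) : hitting e x y ≤ 1 := by
  induction y with
  | nil => exact le_rfl
  | cons j v ih =>
    rw [hitting]
    split_ifs
    · exact mul_le_one₀ ih (sub_nonneg.2 (escapeInf_le_one _))
        (by linarith [escapeInf_nonneg (shift (j :: v) e)])
    · exact le_rfl

theorem hitting_self (e : Vertex b → JumpVector b) (x : Vertex b) : hitting e x x = 1 := by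
  cases x with
  | nil => rfl
  | cons j v =>
    rw [hitting, if_neg]
    intro h
    have := h.length_le
    simp at this

/-- The parent of `x` is not a strict descendant of `x`, even at the root, which is its own parent.
-/
theorem hitting_tail_self (e : Vertex b → JumpVector b) (x : Vertex b) :
    hitting e x x.tail = 1 := by
  cases x with
  | nil => rfl
  | cons j v =>
    cases v with
    | nil => rfl
    | cons k v =>
      rw [List.tail_cons, hitting, if_neg]
      intro h
      have := h.length_le
      simp at this

theorem lintegral_walk_ofReal (e : Vertex b → JumpVector b) (u : Vertex b) {g : Vertex b → ℝ}
    (hg : ∀ v, 0 ≤ g v) :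
    ∫⁻ z, ENNReal.ofReal (g z) ∂(walk e u) =
      ENNReal.ofReal ((e u).1 none * g u.tail + ∑ j, (e u).1 (some j) * g (j :: u)) := by
  have hp : ∀ a, 0 ≤ (e u).1 a := fun a => ((e u).2.1 a).le
  rw [lintegral_walk, ENNReal.ofReal_add (mul_nonneg (hp _) (hg _))
    (Finset.sum_nonneg fun j _ => mul_nonneg (hp _) (hg _)),
    ENNReal.ofReal_sum_of_nonneg fun j _ => mul_nonneg (hp _) (hg _)]
  simp only [ENNReal.ofReal_mul (hp _)]

theorem none_add_sum_some (q : JumpVector b) : q.1 none + ∑ j, q.1 (some j) = 1 := by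
  rw [← Fintype.sum_option q.1]; exact q.2.2

/-- The function `hitting e x` is harmonic at strict descendants of `x` and equals its maximum `1`
elsewhere. From `x` a step to any child lands where it is below `1`; no control of the walk outside
the subtree of `x` is needed. -/
theorem isTransient_of_escapeInf_pos (hb : 1 ≤ b) (e : Vertex b → JumpVector b)
    (h : ∀ u, 0 < escapeInf (shift u e)) : MarkovChain.IsTransient (walk e) := by
  intro x
  refine MarkovChain.law_return_lt_one (walk e) x (fun y => ENNReal.ofReal (hitting e x y))
    (measurable_of_countable _) (by rw [hitting_self, ENNReal.ofReal_one]) (fun y hy => ?_) ?_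
  · rw [lintegral_walk_ofReal e y (hitting_nonneg e x)]
    refine ENNReal.ofReal_le_ofReal ?_
    have hone : (e y).1 none * hitting e x y.tail + ∑ j, (e y).1 (some j) * hitting e x (j :: y) ≤
        1 := by
      refine le_trans ?_ (none_add_sum_some (e y)).le
      exact add_le_add (mul_le_of_le_one_right ((e y).2.1 _).le (hitting_le_one _ _ _))
        (Finset.sum_le_sum fun j _ =>
          mul_le_of_le_one_right ((e y).2.1 _).le (hitting_le_one _ _ _))
    cases y with
    | nil => exact hone
    | cons k v =>
      by_cases hxv : x <:+ v
      · set y : Vertex b := k :: v with hydef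
        have hxy : x <:+ y := hxv.trans (List.suffix_cons k v)
        have hy1 : hitting e x y = hitting e x v * (1 - escapeInf (shift y e)) := by
          rw [hydef, hitting, if_pos hxv]
        have hch : ∀ j, hitting e x (j :: y) =
            hitting e x y * (1 - escapeInf (shift (j :: y) e)) := fun j => by
          rw [hitting, if_pos hxy]
        set S := ∑ j, ratio j (e y) * escapeInf (shift (j :: y) e) with hS
        have hfix : escapeInf (shift y e) = S / (1 + S) := by
          rw [escapeInf_eq]
          simp only [shift_shift, shift_apply, List.nil_append, List.cons_append, hS]
        have hS0 : 0 ≤ S :=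
          Finset.sum_nonneg fun _ _ => mul_nonneg (ratio_pos _ _).le (escapeInf_nonneg _)
        have hβ : 1 - escapeInf (shift y e) = 1 / (1 + S) := by
          rw [hfix]; field_simp; ring
        have hp := (e y).2.1 none
        have hsum : ∑ j, (e y).1 (some j) * hitting e x (j :: y) =
            hitting e x y * (1 - (e y).1 none - (e y).1 none * S) := by
          have h1 : (e y).1 none * S =
              ∑ j, (e y).1 (some j) * escapeInf (shift (j :: y) e) := by
            rw [hS, Finset.mul_sum]
            refine Finset.sum_congr rfl fun j _ => ?_
            rw [ratio, ← mul_assoc, mul_div_cancel₀ _ hp.ne']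
          have h2 : 1 - (e y).1 none = ∑ j, (e y).1 (some j) := by
            rw [sub_eq_iff_eq_add', none_add_sum_some (e y)]
          rw [h1, h2, ← Finset.sum_sub_distrib, Finset.mul_sum]
          refine Finset.sum_congr rfl fun j _ => ?_
          rw [hch]; ring
        -- With `p` the probability of the jump to the parent, the value at the parent is `(1 + S)`
        -- times the value `H` at `y`, and `p (1 + S) H + (1 - p - p S) H = H`.
        rw [hsum, hydef, List.tail_cons, ← hydef, hy1, hβ]
        refine le_of_eq ?_
        field_simp
        ring
      · refine hone.trans (le_of_eq ?_)
        rw [hitting, if_neg hxv]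
  · rw [lintegral_walk_ofReal e x (hitting_nonneg e x), ← ENNReal.ofReal_one]
    refine (ENNReal.ofReal_lt_ofReal_iff one_pos).2 ?_
    rw [hitting_tail_self, mul_one]
    refine lt_of_lt_of_eq ?_ (none_add_sum_some (e x))
    refine add_lt_add_right (Finset.sum_lt_sum_of_nonempty ⟨⟨0, hb⟩, Finset.mem_univ _⟩
      fun j _ => ?_) _
    rw [hitting, if_pos List.suffix_rfl, hitting_self, one_mul]
    have := (e x).2.1 (some j)
    nlinarith [h (j :: x)]

end ColouredTree

theorem proposition1 {b : ℕ} (hb : 2 ≤ b) (c₀ : Fin b)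
    (ν : Fin b → Measure (ColouredTree.JumpVector b)) (hν : ColouredTree.RegularityConditions ν)
    {Ω : Type*} [MeasurableSpace Ω] (μ : Measure Ω) [IsProbabilityMeasure μ]
    (p : ColouredTree.Vertex b → Ω → ColouredTree.JumpVector b)
    (hmeas : ∀ u, Measurable (p u))
    (hindep : iIndepFun p μ)
    (hlaw : ∀ u, μ.map (p u) = ν (ColouredTree.colour c₀ u)) :
    (ColouredTree.lambdaOne ν < 1 →
      ∀ᵐ ω ∂μ, MarkovChain.IsPositiveRecurrent (ColouredTree.walk fun u => p u ω)) ∧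
    (1 < ColouredTree.lambdaOne ν →
      ∀ᵐ ω ∂μ, MarkovChain.IsTransient (ColouredTree.walk fun u => p u ω)) := by
  -- Every colour `i` occurs in the tree, at the vertex `[i]`.
  have hprob : ∀ i, IsProbabilityMeasure (ν i) := fun i => by
    have h := hlaw [i]
    rw [ColouredTree.colour_cons] at h
    rw [← h]
    exact Measure.isProbabilityMeasure_map (hmeas _).aemeasurable
  have hP : μ.map (fun ω u => p u ω) = ColouredTree.envLaw ν c₀ := by
    rw [(iIndepFun_iff_map_fun_eq_infinitePi_map hmeas).1 hindep, ColouredTree.envLaw]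
    simp only [hlaw]
  have hpm : AEMeasurable (fun ω u => p u ω) μ := (measurable_pi_lambda _ hmeas).aemeasurable
  have hD := hν.unit_interval_subset
  constructor
  · intro hl
    obtain ⟨_, ⟨s, hs, rfl⟩, hrho⟩ := exists_lt_of_csInf_lt
      ((Set.nonempty_Icc.2 zero_le_one).image _) hl
    have h := ColouredTree.ae_tsum_cond_ne_top ν hs.1 hs.2 (hD hs) hrho c₀
    rw [← hP] at h
    filter_upwards [ae_of_ae_map hpm h] with ω hω
    exact ColouredTree.isPositiveRecurrent_of_tsum_cond _ hω
  · intro hl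
    have h := ColouredTree.ae_forall_escapeInf_pos ν hb hD hl c₀
    rw [← hP] at h
    filter_upwards [ae_of_ae_map hpm h] with ω hω
    exact ColouredTree.isTransient_of_escapeInf_pos (by omega) _ hω
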